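/- Let $d,r\ge 1$ and $l\ge 0$ be integers and let $0<p<2$. Let $\omega:[0,\infty)\to[0,\infty)$ be non-decreasing with $\omega(0)=0$, such that $\omega$ is $r$-quasiconcave on $[0,1]$, i.e. $\omega(t)>0$ for $0<t\le 1$ and $t\mapsto t^r/\omega(t)$ is non-decreasing on $(0,1]$. (If $\omega$ is given only on $[0,1]$, it may be extended by $\omega(t)=\omega(1)$ for $t>1$.) For $h\in\mathbb{R}^d$ put $\Delta_h^1g(x)=g(x)-g(x+h)$ and $\Delta_h^r=\Delta_h^1\Delta_h^{r-1}$. For a locally integrable $f:\mathbb{R}^d\to\mathbb{C}$ having locally integrable weak derivatives $\partial^\alpha f$ for all multi-indices with $|\alpha|=l$, put $$\omega_r(D^lf,t)_2=\sup_{0<|h|<t,\ |\alpha|=l}\big\|\Delta_h^r(\partial^\alpha f)\big\|_{L^2(\mathbb{R}^d)}\in[0,\infty],\qquad t>0,$$ and let $\operatorname{Lip}^{r,l}_2(\omega;\mathbb{R}^d)$ be the set of all such $f$ with $\sup_{0<t<\infty}\omega_r(D^lf,t)_2/\omega(t)<\infty$. Let $\mathcal{A}_p(\mathbb{R}^d)=\{f\in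 L^2(\mathbb{R}^d):\widehat f\in L^p(\mathbb{R}^d)\}$, where $\widehat f$ is the $L^2$ Fourier transform, $\widehat f(\xi)=\int_{\mathbb{R}^d}f(x)e^{-2\pi i\langle x,\xi\rangle}\,dx$ for $f\in L^1\cap L^2$. Then the following are equivalent: 1. $L^2(\mathbb{R}^d)\cap\operatorname{Lip}^{r,l}_2(\omega;\mathbb{R}^d)\subset\mathcal{A}_p(\mathbb{R}^d)$; 2. one of the following holds: - (i) $d\big(\tfrac1p-\tfrac12\big)<l$; - (ii) $l<d\big(\tfrac1p-\tfrac12\big)<l+r$ and $\displaystyle\int_0^1\omega(t)^p\,t^{p\left(-d\left(\frac1p-\frac12\right)+l\right)}\,\frac{dt}{t}<\infty$; - (iii) $d\big(\tfrac1p-\tfrac12\big)=l$ and $\displaystyle\int_0^1\frac{\omega(t)^p}{\big(\log\frac2t\big)^{p/2}}\,\frac{dt}{t}<\infty$. -/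

import Mathlib

open MeasureTheory Set FourierTransform
open scoped ENNReal

noncomputable section

/-- `ω` is `r`-quasiconcave on `[0,1]`: `ω 0 = 0`, and both `ω t` and `t ^ r / ω t` are
non-decreasing; the quotient is meant for `0 < t`, where `ω` has to be positive. -/
structure IsQuasiconcave (r : ℕ) (ω : ℝ → ℝ) : Prop where
  map_zero : ω 0 = 0
  pos : ∀ t ∈ Ioc (0 : ℝ) 1, 0 < ω t
  monotoneOn : MonotoneOn ω (Icc 0 1)
  monotoneOn_div : MonotoneOn (fun t => t ^ r / ω t) (Ioc 0 1)

/-- The difference `Δ_h g (x) = g x - g (x + h)`; its `r`-fold iterate is `Δ_h^r`. -/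
def diffOp {d : ℕ} (h : EuclideanSpace ℝ (Fin d)) (g : EuclideanSpace ℝ (Fin d) → ℂ) :
    EuclideanSpace ℝ (Fin d) → ℂ :=
  fun x => g x - g (x + h)

/-- The classical partial derivative in the `i`-th coordinate. -/
def partialDeriv {d : ℕ} (i : Fin d) (φ : EuclideanSpace ℝ (Fin d) → ℂ) :
    EuclideanSpace ℝ (Fin d) → ℂ :=
  fun x => fderiv ℝ φ x (EuclideanSpace.single i 1)

/-- The classical partial derivative `∂^α φ = ∂_1^{α_1} ⋯ ∂_d^{α_d} φ` for a multi-index `α`. -/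
def multiDeriv {d : ℕ} (α : Fin d → ℕ) (φ : EuclideanSpace ℝ (Fin d) → ℂ) :
    EuclideanSpace ℝ (Fin d) → ℂ :=
  (List.finRange d).foldr (fun i ψ => (partialDeriv i)^[α i] ψ) φ

/-- `g` is the weak derivative `∂^α f` on `ℝ^d`. -/
structure HasWeakDeriv {d : ℕ} (α : Fin d → ℕ) (f g : EuclideanSpace ℝ (Fin d) → ℂ) : Prop where
  locallyIntegrable : LocallyIntegrable f volume
  locallyIntegrable_deriv : LocallyIntegrable g volume
  integral_eq : ∀ φ : EuclideanSpace ℝ (Fin d) → ℂ, ContDiff ℝ (⊤ : ℕ∞) φ → HasCompactSupport φ →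
    ∫ x, f x * multiDeriv α φ x = (-1) ^ (∑ i, α i) * ∫ x, g x * φ x

/-- The modulus of smoothness
`ω_r(D^l f, t)_2 = sup {‖Δ_h^r (∂^α f)‖_2 : 0 < |h| < t, |α| = l}`, with values in `[0,∞]`.
(The weak derivative `g = ∂^α f` is unique up to null sets, so the supremum over `g` is
over a single value of the norm.) -/
def modulusOfSmoothness {d : ℕ} (r l : ℕ) (f : EuclideanSpace ℝ (Fin d) → ℂ) (t : ℝ) : ℝ≥0∞ :=
  ⨆ (h : EuclideanSpace ℝ (Fin d)) (_ : 0 < ‖h‖ ∧ ‖h‖ < t)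
    (α : Fin d → ℕ) (_ : ∑ i, α i = l)
    (g : EuclideanSpace ℝ (Fin d) → ℂ) (_ : HasWeakDeriv α f g),
    eLpNorm ((diffOp h)^[r] g) 2 volume

/-- The space `Lip^{r,l}_2(ω; ℝ^d)`: all weak derivatives of order `l` exist, and
`sup_{0 < t < ∞} ω_r(D^l f, t)_2 / ω(t) < ∞`. -/
def LipSpace (d r l : ℕ) (ω : ℝ → ℝ) : Set (EuclideanSpace ℝ (Fin d) → ℂ) :=
  {f | (∀ α : Fin d → ℕ, ∑ i, α i = l → ∃ g, HasWeakDeriv α f g) ∧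
    ⨆ (t : ℝ) (_ : 0 < t), modulusOfSmoothness r l f t / ENNReal.ofReal (ω t) < ∞}

/-- The space `L²(ℝ^d)` of complex-valued functions. -/
def L2Space (d : ℕ) : Set (EuclideanSpace ℝ (Fin d) → ℂ) :=
  {f | MemLp f 2 volume}

/-- The space `𝒜_p(ℝ^d)` of all `f ∈ L²(ℝ^d)` whose (Plancherel) Fourier transform is in `L^p`. -/
def WienerSpace (d : ℕ) (p : ℝ) : Set (EuclideanSpace ℝ (Fin d) → ℂ) :=
  {f | ∃ hf : MemLp f 2 volume,
    MemLp (𝓕 (hf.toLp f : Lp ℂ 2 (volume : Measure (EuclideanSpace ℝ (Fin d))))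
      : Lp ℂ 2 (volume : Measure (EuclideanSpace ℝ (Fin d)))) (ENNReal.ofReal p) volume}

end

/-! ### Weak derivatives as Fourier multipliers, and their behaviour under differences. -/

noncomputable section

open scoped SchwartzMap LineDeriv

variable {d : ℕ}

/-! Put `s = d(1/p - 1/2)` and `w n = ω(2^(-n))`, and let `e k` be the integral of `|ξ|^(2l)
|f̂(ξ)|²` over the shell `2^k ≤ |ξ| < 2^(k+1)`. By Plancherel, the square of the `L²` norm of `Δ_h^r
∂^α f` is the integral of `|1 - exp(2πi⟨h,ξ⟩)|^(2r) |(2πξ)^α|² |f̂|²`, and on the `k`-th shell the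
first factor is at most a constant times `min(1, 4^(r(k-n)))` when `|h| ≤ 2^(-n)`. Hölder on a shell
of volume comparable to `2^(kd)` bounds the integral of `|f̂|^p` there by a constant times
`2^(kp(s-l)) (e k)^(p/2)`, and this is sharp when `|f̂|` is constant on the shell. The theorem thus
becomes a question on sequences: which `w` force the series of `2^(kp(s-l)) (e k)^(p/2)` to
converge?

Sufficiency. Averaging over steps `h` along the axes gives the tail bound `∑_{k ≥ n} e k ≤ C (w n)²`
(`lintegral_coord_ge_le`, `exists_lintegral_tail_le`). If `s < l`, the geometric weight wins against
bounded energies. If `l < s`, the bound on the single term `e n` is enough. If `s = l`, single terms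
are too crude: Hölder over the blocks `2^j ≤ k < 2^(j+1)`, applied to the tail bound, and Cauchy
condensation produce the factor `n^(-p/2)`, which is the logarithm of the integral condition
(`tsum_rpow_lt_top_of_tail`).

Necessity. Any energies with `∑_k min(1, 4^(r(k-n))) e k ≤ C (w n)²` are realised by an `f` whose
Fourier transform is constant on shells (`exists_mem_lipSpace_of_energy`), so it remains to find
such energies with divergent series. If `w` stays away from `0`, or if `s ≥ l + r`, perturbed
harmonic series do it. If `l < s < l + r`, then `(w n)²` is comparable to a concave function at the
points `4^(-rn)`; a concave function vanishing at `0` is a superposition of functions `min(x, y)`,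
and the masses of this superposition give the energies. A Schur test shows that convergence for them
would force convergence of the series of `2^(np(s-l)) (w n)^p`. If `s = l`, the decrements of `w²`
along powers of two are spread evenly over the blocks, which makes the block Hölder inequality an
equality; Schur's test and condensation again transfer convergence back to `w`.

The integrals over `(0,1)` are replaced by series by `lintegral_rpow_mul_lt_top_iff`. -/

/-- The iterated partial derivative `∂^α` on Schwartz functions. -/
def SchwartzMap.multiDeriv (α : Fin d → ℕ) (φ : 𝓢(EuclideanSpace ℝ (Fin d), ℂ)) :
    𝓢(EuclideanSpace ℝ (Fin d), ℂ) :=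
  (List.finRange d).foldr
    (fun i ψ => (fun χ : 𝓢(EuclideanSpace ℝ (Fin d), ℂ) => ∂_{EuclideanSpace.single i (1 : ℝ)} χ)^[α i] ψ) φ

/-- The Fourier symbol `(2πiξ)^α` of `∂^α`. -/
def derivSymbol (α : Fin d → ℕ) (ξ : EuclideanSpace ℝ (Fin d)) : ℂ :=
  ∏ i, (2 * Real.pi * Complex.I * (ξ i : ℂ)) ^ α i

theorem SchwartzMap.coe_multiDeriv (α : Fin d → ℕ) (φ : 𝓢(EuclideanSpace ℝ (Fin d), ℂ)) :
    ⇑(φ.multiDeriv α) = _root_.multiDeriv α ⇑φ := by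
  unfold SchwartzMap.multiDeriv _root_.multiDeriv
  induction List.finRange d with
  | nil => rfl
  | cons i L ih =>
    simp only [List.foldr_cons]
    rw [← ih]
    generalize (List.foldr _ φ L) = ψ
    induction α i generalizing ψ with
    | zero => rfl
    | succ n ihn =>
      rw [Function.iterate_succ_apply, Function.iterate_succ_apply, ihn]
      rfl

theorem SchwartzMap.fourierInv_multiDeriv (α : Fin d → ℕ) (φ : 𝓢(EuclideanSpace ℝ (Fin d), ℂ))
    (ξ : EuclideanSpace ℝ (Fin d)) :
    𝓕⁻ (φ.multiDeriv α) ξ = (-1) ^ (∑ i, α i) * derivSymbol α ξ * 𝓕⁻ φ ξ := by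
  have key : ∀ L : List (Fin d), 𝓕⁻ (L.foldr (fun i ψ =>
      (fun χ : 𝓢(EuclideanSpace ℝ (Fin d), ℂ) =>
        ∂_{EuclideanSpace.single i (1 : ℝ)} χ)^[α i] ψ) φ) ξ =
      (L.map fun i => (-(2 * Real.pi * Complex.I * (ξ i : ℂ))) ^ α i).prod * 𝓕⁻ φ ξ := by
    intro L
    induction L with
    | nil => simp
    | cons i L ih =>
      simp only [List.foldr_cons, List.map_cons, List.prod_cons]
      rw [mul_assoc, ← ih]
      generalize (List.foldr _ φ L) = ψ
      induction α i generalizing ψ with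
      | zero => simp
      | succ n ihn =>
        rw [Function.iterate_succ_apply, ihn, fourierInv_lineDerivOp_eq]
        have : (inner ℝ · (EuclideanSpace.single i (1 : ℝ)) :
          EuclideanSpace ℝ (Fin d) → ℝ).HasTemperateGrowth := by fun_prop
        simp only [neg_apply, smul_apply, smul_eq_mul, neg_smul]
        rw [smulLeftCLM_apply_apply this]
        simp [EuclideanSpace.inner_single_right, pow_succ]
        ring
  unfold SchwartzMap.multiDeriv
  rw [key, derivSymbol, ← Finset.prod_pow_eq_pow_sum, ← Finset.prod_mul_distrib, ← List.ofFn_eq_map,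
    List.prod_ofFn]
  congr 1
  refine Finset.prod_congr rfl fun i _ => ?_
  rw [← mul_pow]; ring

/-- Compatibility of the Plancherel transform with the distributional one. It moves every identity
tested against smooth functions to the frequency side. -/
theorem integral_mul_schwartz_eq_fourier (u : Lp ℂ 2 (volume : Measure (EuclideanSpace ℝ (Fin d))))
    (φ : 𝓢(EuclideanSpace ℝ (Fin d), ℂ)) :
    ∫ x, u x * φ x = ∫ ξ, (𝓕 u : Lp ℂ 2 (volume : Measure (EuclideanSpace ℝ (Fin d)))) ξ * 𝓕⁻ φ ξ := by
  have h := congrArg (fun T => T φ) (Lp.fourierInv_toTemperedDistribution_eq (𝓕 u))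
  simp only [TemperedDistribution.fourierInv_apply, Lp.toTemperedDistribution_apply, smul_eq_mul,
    fourierInv_fourier_eq] at h
  simp only [mul_comm] at h ⊢
  exact h.symm

theorem hasWeakDeriv_of_fourier_eq (α : Fin d → ℕ)
    (u v : Lp ℂ 2 (volume : Measure (EuclideanSpace ℝ (Fin d))))
    (h : ∀ᵐ ξ, (𝓕 v : Lp ℂ 2 (volume : Measure (EuclideanSpace ℝ (Fin d)))) ξ = derivSymbol α ξ *
      (𝓕 u : Lp ℂ 2 (volume : Measure (EuclideanSpace ℝ (Fin d)))) ξ) :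
    HasWeakDeriv α u v := by
  refine ⟨(Lp.memLp u).locallyIntegrable (by norm_num), (Lp.memLp v).locallyIntegrable (by norm_num),
    fun φ hφ hc => ?_⟩
  set ψ := hc.toSchwartzMap hφ
  have hψ : ⇑ψ = φ := rfl
  rw [← hψ, ← SchwartzMap.coe_multiDeriv, integral_mul_schwartz_eq_fourier u,
    integral_mul_schwartz_eq_fourier v, ← integral_const_mul]
  refine integral_congr_ae ?_
  filter_upwards [h] with ξ hξ
  rw [hξ, SchwartzMap.fourierInv_multiDeriv]
  ring

theorem ae_eq_of_integral_mul_smooth_eq {f g : EuclideanSpace ℝ (Fin d) → ℂ}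
    (hf : LocallyIntegrable f volume) (hg : LocallyIntegrable g volume)
    (h : ∀ φ : EuclideanSpace ℝ (Fin d) → ℂ, ContDiff ℝ (⊤ : ℕ∞) φ → HasCompactSupport φ →
      ∫ x, f x * φ x = ∫ x, g x * φ x) : ∀ᵐ x, f x = g x := by
  refine ae_eq_of_integral_contDiff_smul_eq hf hg fun φ hφ hc => ?_
  have := h (fun x => (φ x : ℂ)) (Complex.ofRealCLM.contDiff.comp hφ) (hc.comp_left Complex.ofReal_zero)
  simpa [mul_comm] using this

theorem HasWeakDeriv.ae_eq {α : Fin d → ℕ} {f g g' : EuclideanSpace ℝ (Fin d) → ℂ}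
    (h : HasWeakDeriv α f g) (h' : HasWeakDeriv α f g') : ∀ᵐ x, g x = g' x := by
  refine ae_eq_of_integral_mul_smooth_eq h.locallyIntegrable_deriv h'.locallyIntegrable_deriv
    fun φ hφ hc => ?_
  have := (h.integral_eq φ hφ hc).symm.trans (h'.integral_eq φ hφ hc)
  exact mul_left_cancel₀ (pow_ne_zero _ (by norm_num)) this

theorem multiDeriv_comp_add_right (α : Fin d → ℕ) (φ : EuclideanSpace ℝ (Fin d) → ℂ)
    (h : EuclideanSpace ℝ (Fin d)) :
    multiDeriv α (fun x => φ (x + h)) = fun x => multiDeriv α φ (x + h) := by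
  unfold multiDeriv
  induction List.finRange d with
  | nil => rfl
  | cons i L ih =>
    simp only [List.foldr_cons]
    rw [ih]
    generalize (List.foldr _ φ L) = ψ
    induction α i generalizing ψ with
    | zero => rfl
    | succ n ihn =>
      rw [Function.iterate_succ_apply, Function.iterate_succ_apply, ← ihn]
      congr 1
      ext x
      simp [partialDeriv, fderiv_comp_add_right]

/-- The derivative of an `L²` function need not be in `L²`, while its `r`-th difference is for
functions in the Lipschitz class. Hence differences are taken before Plancherel is applied, and they
must commute with weak derivatives. -/
theorem HasWeakDeriv.diffOp {α : Fin d → ℕ} {f g : EuclideanSpace ℝ (Fin d) → ℂ}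
    (h : HasWeakDeriv α f g) (y : EuclideanSpace ℝ (Fin d)) :
    HasWeakDeriv α (diffOp y f) (diffOp y g) := by
  have loc : ∀ {u : EuclideanSpace ℝ (Fin d) → ℂ}, LocallyIntegrable u volume →
      LocallyIntegrable (fun x => u (x + y)) volume := by
    intro u hu
    have := (locallyIntegrable_map_homeomorph (Homeomorph.addRight y) (f := u) (μ := volume)).1
      (by rw [show Measure.map (Homeomorph.addRight y) volume = volume from map_add_right_eq_self _ y]; exact hu)
    exact this
  refine ⟨h.locallyIntegrable.sub (loc h.locallyIntegrable),
    h.locallyIntegrable_deriv.sub (loc h.locallyIntegrable_deriv), fun φ hφ hc => ?_⟩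
  have int : ∀ {u : EuclideanSpace ℝ (Fin d) → ℂ} (ψ : EuclideanSpace ℝ (Fin d) → ℂ),
      LocallyIntegrable u volume → Continuous ψ → HasCompactSupport ψ →
      Integrable (fun x => u x * ψ x) := by
    intro u ψ hu hψ hs
    have := hu.integrable_smul_left_of_hasCompactSupport hψ hs
    simpa [mul_comm] using this
  set ψ := hc.toSchwartzMap hφ
  have hψ : ⇑ψ = φ := rfl
  have hD : Continuous (multiDeriv α φ) := by
    rw [← hψ, ← SchwartzMap.coe_multiDeriv]; exact SchwartzMap.continuous _
  have hDc : HasCompactSupport (multiDeriv α φ) := by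
    unfold multiDeriv
    induction List.finRange d with
    | nil => exact hc
    | cons i L ih =>
      simp only [List.foldr_cons]
      generalize (List.foldr _ φ L) = χ at ih
      induction α i generalizing χ with
      | zero => exact ih
      | succ n ihn =>
        rw [Function.iterate_succ_apply]
        refine ihn _ ?_
        exact ih.fderiv_apply (𝕜 := ℝ) _
  have shift : ∀ u v : EuclideanSpace ℝ (Fin d) → ℂ,
      ∫ x, u (x + y) * v x = ∫ x, u x * v (x + -y) := by
    intro u v
    rw [← integral_add_right_eq_self (fun x => u x * v (x + -y)) y]
    simp
  have hφ' : ContDiff ℝ (⊤ : ℕ∞) (fun x => φ (x + -y)) := hφ.comp (contDiff_id.add contDiff_const)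
  have hc' : HasCompactSupport (fun x => φ (x + -y)) := hc.comp_homeomorph (Homeomorph.addRight (-y))
  have e := h.integral_eq _ hφ hc
  have e' := h.integral_eq _ hφ' hc'
  rw [multiDeriv_comp_add_right, ← shift, ← shift] at e'
  simp only [_root_.diffOp, sub_mul]
  rw [integral_sub (int _ h.locallyIntegrable hD hDc) (int _ (loc h.locallyIntegrable) hD hDc),
    integral_sub (int _ h.locallyIntegrable_deriv hφ.continuous hc)
      (int _ (loc h.locallyIntegrable_deriv) hφ.continuous hc), e, e', mul_sub]

theorem HasWeakDeriv.iterate_diffOp {α : Fin d → ℕ} {f g : EuclideanSpace ℝ (Fin d) → ℂ}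
    (h : HasWeakDeriv α f g) (y : EuclideanSpace ℝ (Fin d)) (r : ℕ) :
    HasWeakDeriv α ((_root_.diffOp y)^[r] f) ((_root_.diffOp y)^[r] g) := by
  induction r with
  | zero => exact h
  | succ r ih =>
    rw [Function.iterate_succ_apply', Function.iterate_succ_apply']
    exact ih.diffOp y

end

/-! ### Fourier side of weak derivatives, translations and differences. -/

noncomputable section

open scoped SchwartzMap LineDeriv RealInnerProductSpace

variable {d : ℕ}

theorem integrable_Lp_mul_schwartz (u : Lp ℂ 2 (volume : Measure (EuclideanSpace ℝ (Fin d))))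
    (φ : 𝓢(EuclideanSpace ℝ (Fin d), ℂ)) : Integrable (fun x => u x * φ x) :=
  (Lp.memLp u).integrable_mul (φ.memLp 2 volume)

/-- The Fourier transform is injective on integrable functions. -/
theorem MeasureTheory.Integrable.ae_eq_zero_of_fourier_eq_zero
    {W : EuclideanSpace ℝ (Fin d) → ℂ} (hW : Integrable W)
    (h : ∀ y, ∫ ξ, Complex.exp (2 * Real.pi * Complex.I * ⟪y, ξ⟫) * W ξ = 0) :
    ∀ᵐ ξ, W ξ = 0 := by
  refine ae_eq_of_integral_mul_smooth_eq hW.locallyIntegrable (locallyIntegrable_const 0)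
    fun φ hφ hc => ?_
  have hF : 𝓕 W = 0 := by
    ext y
    rw [Real.fourier_eq', Pi.zero_apply, ← h (-y)]
    refine integral_congr_ae (.of_forall fun ξ => ?_)
    simp only [smul_eq_mul]
    congr 2
    rw [inner_neg_left, real_inner_comm]
    push_cast
    ring
  -- Multiplication formula, with the test function written as `𝓕 (𝓕⁻ φ)`: the pairing of `W` with
  -- `φ` equals that of `𝓕 W = 0` with `𝓕⁻ φ`.
  have := VectorFourier.integral_fourierIntegral_smul_eq_flip (μ := volume) (ν := volume) (L := innerₗ (EuclideanSpace ℝ (Fin d)))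
    Real.continuous_fourierChar (by exact continuous_inner) hW
    (g := ⇑(𝓕⁻ (hc.toSchwartzMap hφ) : 𝓢(EuclideanSpace ℝ (Fin d), ℂ))) (SchwartzMap.integrable _)
  have e1 : VectorFourier.fourierIntegral Real.fourierChar volume (innerₗ (EuclideanSpace ℝ (Fin d))) W = 𝓕 W := rfl
  have e2 : VectorFourier.fourierIntegral Real.fourierChar volume (innerₗ (EuclideanSpace ℝ (Fin d))).flip
      (⇑(𝓕⁻ (hc.toSchwartzMap hφ) : 𝓢(EuclideanSpace ℝ (Fin d), ℂ))) = φ := by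
    rw [flip_innerₗ]
    change 𝓕 (⇑(𝓕⁻ (hc.toSchwartzMap hφ) : 𝓢(EuclideanSpace ℝ (Fin d), ℂ))) = φ
    rw [← SchwartzMap.fourier_coe]
    exact congrArg DFunLike.coe (FourierTransform.fourier_fourierInv_eq (hc.toSchwartzMap hφ))
  rw [e1, e2, hF] at this
  simpa using this.symm

theorem fourierInv_comp_add_right (φ : EuclideanSpace ℝ (Fin d) → ℂ) (y ξ : EuclideanSpace ℝ (Fin d)) :
    𝓕⁻ (fun x => φ (x + -y)) ξ = Complex.exp (2 * Real.pi * Complex.I * ⟪y, ξ⟫) * 𝓕⁻ φ ξ := by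
  rw [Real.fourierInv_eq', Real.fourierInv_eq', ← integral_const_mul,
    ← integral_add_right_eq_self _ y]
  refine integral_congr_ae (.of_forall fun x => ?_)
  simp only [smul_eq_mul, add_neg_cancel_right, inner_add_left]
  rw [← mul_assoc, ← Complex.exp_add]
  congr 2
  push_cast
  ring

theorem fourier_comp_add_right_neg (φ : EuclideanSpace ℝ (Fin d) → ℂ) (y x : EuclideanSpace ℝ (Fin d)) :
    𝓕 (fun ξ => Complex.exp (2 * Real.pi * Complex.I * ⟪y, ξ⟫) * φ ξ) x = 𝓕 φ (x + -y) := by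
  rw [Real.fourier_eq', Real.fourier_eq']
  refine integral_congr_ae (.of_forall fun ξ => ?_)
  simp only [smul_eq_mul, inner_add_right, inner_neg_right]
  rw [← mul_assoc, ← Complex.exp_add]
  congr 2
  rw [real_inner_comm y ξ]
  push_cast
  ring

/-- A bump supported in radius `1/(4(n+1))` keeps the phase `2π⟨x,ξ⟩` inside `(-π/2, π/2)` for `‖ξ‖
≤ n`, so the real part of the transform is the integral of a nonnegative, nonzero function. -/
theorem exists_smooth_fourierInv_ne_zero (n : ℕ) : ∃ φ : EuclideanSpace ℝ (Fin d) → ℂ,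
    ContDiff ℝ (⊤ : ℕ∞) φ ∧ HasCompactSupport φ ∧ ∀ ξ, ‖ξ‖ ≤ n → 𝓕⁻ φ ξ ≠ 0 := by
  have hpos : (0 : ℝ) < 1 / (8 * (n + 1)) := by positivity
  obtain ⟨b, hb⟩ : ∃ b : ContDiffBump (0 : EuclideanSpace ℝ (Fin d)), b.rOut = 2 * (1 / (8 * (n + 1))) :=
    ⟨⟨1 / (8 * (n + 1)), 2 * (1 / (8 * (n + 1))), hpos, by linarith⟩, rfl⟩
  refine ⟨fun x => (b x : ℂ), Complex.ofRealCLM.contDiff.comp b.contDiff,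
    b.hasCompactSupport.comp_left Complex.ofReal_zero, fun ξ hξ h0 => ?_⟩
  have hre : ∫ x, Real.cos (2 * Real.pi * ⟪x, ξ⟫) * b x = 0 := by
    rw [Real.fourierInv_eq'] at h0
    have hi : Integrable (fun v => Complex.exp (↑(2 * Real.pi * ⟪v, ξ⟫) * Complex.I) * (b v : ℂ)) := by
      have c1 : Continuous fun v => Complex.exp (↑(2 * Real.pi * ⟪v, ξ⟫) * Complex.I) := by fun_prop
      have c2 : Continuous fun v => (b v : ℂ) := Complex.continuous_ofReal.comp b.continuous
      have c3 : HasCompactSupport fun v => (b v : ℂ) := b.hasCompactSupport.comp_left Complex.ofReal_zero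
      exact (c1.mul c2).integrable_of_hasCompactSupport c3.mul_left
    simp only [smul_eq_mul] at h0
    have := congrArg Complex.re h0
    rw [← Complex.reCLM_apply, ← ContinuousLinearMap.integral_comp_comm _ hi] at this
    rw [← Complex.zero_re, ← this]
    refine integral_congr_ae (.of_forall fun x => ?_)
    beta_reduce
    rw [Complex.reCLM_apply, Complex.re_mul_ofReal, Complex.exp_ofReal_mul_I_re]
  have hcos : ∀ x, b x ≠ 0 → 0 < Real.cos (2 * Real.pi * ⟪x, ξ⟫) := by
    intro x hx
    have hx' : ‖x‖ < 2 * (1 / (8 * (n + 1))) := by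
      have : x ∈ Function.support b := hx
      rw [b.support_eq, hb] at this
      simpa using this
    have hin : |⟪x, ξ⟫| < 1 / 4 := by
      calc |⟪x, ξ⟫| ≤ ‖x‖ * ‖ξ‖ := abs_real_inner_le_norm _ _
        _ ≤ ‖x‖ * (n + 1) := by gcongr; linarith
        _ < 2 * (1 / (8 * (n + 1))) * (n + 1) := by gcongr
        _ = 1 / 4 := by field_simp; norm_num
    rw [abs_lt] at hin
    refine Real.cos_pos_of_mem_Ioo ⟨?_, ?_⟩ <;> nlinarith [Real.pi_pos]
  refine (Continuous.integral_pos_of_hasCompactSupport_nonneg_nonzero (x := 0) (μ := volume)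
    (f := fun x => Real.cos (2 * Real.pi * ⟪x, ξ⟫) * b x) ?_ ?_ ?_ ?_).ne' hre
  · exact (by fun_prop : Continuous fun x => Real.cos (2 * Real.pi * ⟪x, ξ⟫)).mul b.continuous
  · exact b.hasCompactSupport.mul_left
  · intro x
    by_cases hx : b x = 0
    · simp [hx]
    · exact mul_nonneg (hcos x hx).le b.nonneg
  · simp [(b.pos_of_mem_ball (Metric.mem_ball_self b.rOut_pos)).ne']

/-- The difference of the two sides need not be integrable, but its product with `𝓕⁻ φ` is, for
every test function `φ`. Translating `φ` multiplies `𝓕⁻ φ` by a character, so the whole Fourier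
transform of this product vanishes and the product is zero. Test functions with `𝓕⁻ φ` nonzero on
larger and larger balls then remove the factor. -/
theorem fourier_eq_of_hasWeakDeriv {α : Fin d → ℕ}
    {u v : Lp ℂ 2 (volume : Measure (EuclideanSpace ℝ (Fin d)))} (h : HasWeakDeriv α u v) :
    ∀ᵐ ξ, (𝓕 v : Lp ℂ 2 (volume : Measure (EuclideanSpace ℝ (Fin d)))) ξ = derivSymbol α ξ *
      (𝓕 u : Lp ℂ 2 (volume : Measure (EuclideanSpace ℝ (Fin d)))) ξ := by
  have key : ∀ φ : EuclideanSpace ℝ (Fin d) → ℂ, ContDiff ℝ (⊤ : ℕ∞) φ → HasCompactSupport φ →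
      ∀ᵐ ξ, ((𝓕 v : Lp ℂ 2 (volume : Measure (EuclideanSpace ℝ (Fin d)))) ξ - derivSymbol α ξ *
      (𝓕 u : Lp ℂ 2 (volume : Measure (EuclideanSpace ℝ (Fin d)))) ξ) * 𝓕⁻ φ ξ = 0 := by
    intro φ hφ hc
    have hint : ∀ φ : EuclideanSpace ℝ (Fin d) → ℂ, ContDiff ℝ (⊤ : ℕ∞) φ → HasCompactSupport φ →
      Integrable (fun ξ => ((𝓕 v : Lp ℂ 2 (volume : Measure (EuclideanSpace ℝ (Fin d)))) ξ - derivSymbol α ξ *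
        (𝓕 u : Lp ℂ 2 (volume : Measure (EuclideanSpace ℝ (Fin d)))) ξ) * 𝓕⁻ φ ξ) ∧
      ∫ ξ, ((𝓕 v : Lp ℂ 2 (volume : Measure (EuclideanSpace ℝ (Fin d)))) ξ - derivSymbol α ξ *
        (𝓕 u : Lp ℂ 2 (volume : Measure (EuclideanSpace ℝ (Fin d)))) ξ) * 𝓕⁻ φ ξ = 0 := by
      intro φ hφ hc
      set ψ := hc.toSchwartzMap hφ
      have hψ : ⇑ψ = φ := rfl
      rw [← hψ, ← SchwartzMap.fourierInv_coe]
      have i1 := integrable_Lp_mul_schwartz (𝓕 v) (𝓕⁻ ψ)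
      have i2 := (integrable_Lp_mul_schwartz (𝓕 u) (𝓕⁻ (ψ.multiDeriv α))).const_mul ((-1) ^ (∑ i, α i))
      have e : (fun ξ => ((𝓕 v : Lp ℂ 2 (volume : Measure (EuclideanSpace ℝ (Fin d)))) ξ - derivSymbol α ξ *
        (𝓕 u : Lp ℂ 2 (volume : Measure (EuclideanSpace ℝ (Fin d)))) ξ) * 𝓕⁻ ψ ξ) = fun ξ =>
          (𝓕 v : Lp ℂ 2 (volume : Measure (EuclideanSpace ℝ (Fin d)))) ξ * 𝓕⁻ ψ ξ - (-1) ^ (∑ i, α i) *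
          ((𝓕 u : Lp ℂ 2 (volume : Measure (EuclideanSpace ℝ (Fin d)))) ξ * 𝓕⁻ (ψ.multiDeriv α) ξ) := by
        ext ξ
        rw [SchwartzMap.fourierInv_multiDeriv]
        have : ((-1 : ℂ) ^ (∑ i, α i)) * (-1) ^ (∑ i, α i) = 1 := by
          rw [← mul_pow]; simp
        linear_combination (𝓕 u : Lp ℂ 2 (volume : Measure (EuclideanSpace ℝ (Fin d)))) ξ *
          derivSymbol α ξ * 𝓕⁻ ψ ξ * this
      rw [e]
      refine ⟨i1.sub i2, ?_⟩
      rw [integral_sub i1 i2, integral_const_mul, ← integral_mul_schwartz_eq_fourier v,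
        ← integral_mul_schwartz_eq_fourier u, SchwartzMap.coe_multiDeriv, hψ, h.integral_eq φ hφ hc,
        ← mul_assoc, ← mul_pow]
      simp
    refine (hint φ hφ hc).1.ae_eq_zero_of_fourier_eq_zero fun y => ?_
    have := (hint (fun x => φ (x + -y)) (hφ.comp (contDiff_id.add contDiff_const))
      (hc.comp_homeomorph (Homeomorph.addRight (-y)))).2
    rw [← this]
    refine integral_congr_ae (.of_forall fun ξ => ?_)
    simp only [fourierInv_comp_add_right]
    ring
  choose φ hφ hc hne using fun n => exists_smooth_fourierInv_ne_zero (d := d) n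
  filter_upwards [ae_all_iff.2 fun n => key (φ n) (hφ n) (hc n)] with ξ hξ
  obtain ⟨n, hn⟩ := exists_nat_ge ‖ξ‖
  exact sub_eq_zero.1 ((mul_eq_zero.1 (hξ n)).resolve_right (hne n ξ hn))

theorem memLp_comp_add_right {f : EuclideanSpace ℝ (Fin d) → ℂ} (hf : MemLp f 2 volume)
    (y : EuclideanSpace ℝ (Fin d)) : MemLp (fun x => f (x + y)) 2 volume :=
  hf.comp_measurePreserving (measurePreserving_add_right volume y)

/-- By duality: the character is moved onto the test function, whose Fourier transform it
translates, and a change of variables moves the translation onto `f`. -/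
theorem fourier_toLp_comp_add_right {f : EuclideanSpace ℝ (Fin d) → ℂ} (hf : MemLp f 2 volume)
    (y : EuclideanSpace ℝ (Fin d)) :
    ∀ᵐ ξ, (𝓕 ((memLp_comp_add_right hf y).toLp _) : Lp ℂ 2 (volume : Measure (EuclideanSpace ℝ (Fin d)))) ξ =
      Complex.exp (2 * Real.pi * Complex.I * ⟪y, ξ⟫) *
      (𝓕 (hf.toLp f) : Lp ℂ 2 (volume : Measure (EuclideanSpace ℝ (Fin d)))) ξ := by
  have l1 := (Lp.memLp (𝓕 ((memLp_comp_add_right hf y).toLp _) :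
    Lp ℂ 2 (volume : Measure (EuclideanSpace ℝ (Fin d))))).locallyIntegrable (by norm_num)
  have l2 := (Lp.memLp (𝓕 (hf.toLp f) :
    Lp ℂ 2 (volume : Measure (EuclideanSpace ℝ (Fin d))))).locallyIntegrable (by norm_num)
  refine ae_eq_of_integral_mul_smooth_eq l1 ?_ fun φ hφ hc => ?_
  · simp only [mul_comm (Complex.exp _)]
    exact l2.mul_continuous (by fun_prop)
  have hφ' : ContDiff ℝ (⊤ : ℕ∞) (fun ξ => Complex.exp (2 * Real.pi * Complex.I * ⟪y, ξ⟫) * φ ξ) := by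
    refine ContDiff.mul (ContDiff.cexp (contDiff_const.mul ?_)) hφ
    exact Complex.ofRealCLM.contDiff.comp (contDiff_const.inner ℝ contDiff_id)
  have hc' : HasCompactSupport (fun ξ => Complex.exp (2 * Real.pi * Complex.I * ⟪y, ξ⟫) * φ ξ) :=
    hc.mul_left
  set Φ := hc.toSchwartzMap hφ
  set Φ' := hc'.toSchwartzMap hφ'
  have e1 := integral_mul_schwartz_eq_fourier ((memLp_comp_add_right hf y).toLp _) (𝓕 Φ)
  have e2 := integral_mul_schwartz_eq_fourier (hf.toLp f) (𝓕 Φ')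
  rw [fourierInv_fourier_eq] at e1 e2
  have h1 : ⇑Φ = φ := rfl
  have h2 : ⇑Φ' = fun ξ => Complex.exp (2 * Real.pi * Complex.I * ⟪y, ξ⟫) * φ ξ := rfl
  rw [← h1, ← e1]
  calc _ = ∫ x, f (x + y) * 𝓕 Φ x := by
        refine integral_congr_ae ?_
        filter_upwards [(memLp_comp_add_right hf y).coeFn_toLp] with x hx
        rw [hx]
    _ = ∫ x, f x * 𝓕 Φ (x + -y) := by
        rw [← integral_add_right_eq_self (fun x => f x * 𝓕 Φ (x + -y)) y]; simp
    _ = ∫ x, hf.toLp f x * 𝓕 Φ' x := by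
        refine integral_congr_ae ?_
        filter_upwards [hf.coeFn_toLp] with x hx
        rw [hx, SchwartzMap.fourier_coe, SchwartzMap.fourier_coe, h2, fourier_comp_add_right_neg, h1]
    _ = _ := by
        rw [e2]
        refine integral_congr_ae (.of_forall fun ξ => ?_)
        simp only [h2, h1]; ring

theorem MeasureTheory.MemLp.diffOp {f : EuclideanSpace ℝ (Fin d) → ℂ} (hf : MemLp f 2 volume)
    (y : EuclideanSpace ℝ (Fin d)) : MemLp (diffOp y f) 2 volume :=
  hf.sub (memLp_comp_add_right hf y)

theorem MeasureTheory.MemLp.iterate_diffOp {f : EuclideanSpace ℝ (Fin d) → ℂ} (hf : MemLp f 2 volume)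
    (y : EuclideanSpace ℝ (Fin d)) (r : ℕ) : MemLp ((_root_.diffOp y)^[r] f) 2 volume := by
  induction r with
  | zero => exact hf
  | succ r ih =>
    rw [Function.iterate_succ_apply']
    exact ih.diffOp y

theorem fourier_toLp_iterate_diffOp {f : EuclideanSpace ℝ (Fin d) → ℂ} (hf : MemLp f 2 volume)
    (y : EuclideanSpace ℝ (Fin d)) (r : ℕ) :
    ∀ᵐ ξ, (𝓕 ((hf.iterate_diffOp y r).toLp _) : Lp ℂ 2 (volume : Measure (EuclideanSpace ℝ (Fin d)))) ξ =
      (1 - Complex.exp (2 * Real.pi * Complex.I * ⟪y, ξ⟫)) ^ r *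
      (𝓕 (hf.toLp f) : Lp ℂ 2 (volume : Measure (EuclideanSpace ℝ (Fin d)))) ξ := by
  induction r with
  | zero => simp
  | succ r ih =>
    have hg := hf.iterate_diffOp y r
    have e : (hf.iterate_diffOp y (r + 1)).toLp _ =
        hg.toLp _ - (memLp_comp_add_right hg y).toLp _ := by
      rw [← MemLp.toLp_sub]
      congr 1
      rw [Function.iterate_succ_apply']
      rfl
    rw [e, show 𝓕 (hg.toLp _ - (memLp_comp_add_right hg y).toLp _) =
      𝓕 (hg.toLp _) - 𝓕 ((memLp_comp_add_right hg y).toLp _) from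
      map_sub (Lp.fourierTransformₗᵢ (EuclideanSpace ℝ (Fin d)) ℂ) (hg.toLp _) _]
    filter_upwards [ih, fourier_toLp_comp_add_right hg y, Lp.coeFn_sub
      (𝓕 (hg.toLp _) : Lp ℂ 2 (volume : Measure (EuclideanSpace ℝ (Fin d))))
      (𝓕 ((memLp_comp_add_right hg y).toLp _))] with ξ h1 h2 h3
    rw [h3, Pi.sub_apply, h2, h1]
    ring

end

/-! ### Direct estimate: the modulus of smoothness controls the tail of the spectrum. -/

noncomputable section

open scoped SchwartzMap LineDeriv RealInnerProductSpace

variable {d : ℕ}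

theorem eLpNorm_two_sq_eq_lintegral (f : EuclideanSpace ℝ (Fin d) → ℂ) :
    eLpNorm f 2 volume ^ 2 = ∫⁻ x, ‖f x‖ₑ ^ 2 := by
  have := eLpNorm_nnreal_pow_eq_lintegral (f := f) (μ := volume) (p := 2) (by norm_num)
  simp only [NNReal.coe_ofNat, ENNReal.coe_ofNat, ENNReal.rpow_ofNat] at this
  exact this

theorem eLpNorm_fourier_toLp {f : EuclideanSpace ℝ (Fin d) → ℂ} (hf : MemLp f 2 volume) :
    eLpNorm (𝓕 (hf.toLp f) : Lp ℂ 2 (volume : Measure (EuclideanSpace ℝ (Fin d)))) 2 volume =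
      eLpNorm f 2 volume := by
  rw [← Lp.enorm_toLp hf, ← Lp.enorm_def, ← ofReal_norm, ← ofReal_norm, Lp.norm_fourier_eq]

theorem HasWeakDeriv.congr_ae {α : Fin d → ℕ} {f g f' g' : EuclideanSpace ℝ (Fin d) → ℂ}
    (h : HasWeakDeriv α f g) (hf : f =ᵐ[volume] f') (hg : g =ᵐ[volume] g') : HasWeakDeriv α f' g' := by
  refine ⟨(locallyIntegrable_congr hf).1 h.locallyIntegrable,
    (locallyIntegrable_congr hg).1 h.locallyIntegrable_deriv, fun φ hφ hc => ?_⟩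
  refine Eq.trans ?_ ((h.integral_eq φ hφ hc).trans ?_)
  · exact (integral_congr_ae (hf.mul (.refl _ (multiDeriv α φ)))).symm
  · exact congrArg _ (integral_congr_ae (hg.mul (.refl _ φ)))

theorem eLpNorm_iterate_diffOp_sq {α : Fin d → ℕ} {f g : EuclideanSpace ℝ (Fin d) → ℂ}
    (hf : MemLp f 2 volume) (h : HasWeakDeriv α f g) (y : EuclideanSpace ℝ (Fin d)) (r : ℕ)
    (hg : MemLp ((diffOp y)^[r] g) 2 volume) :
    eLpNorm ((diffOp y)^[r] g) 2 volume ^ 2 =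
      ∫⁻ ξ, ‖1 - Complex.exp (2 * Real.pi * Complex.I * ⟪y, ξ⟫)‖ₑ ^ (2 * r) * ‖derivSymbol α ξ‖ₑ ^ 2 *
        ‖(𝓕 (hf.toLp f) : Lp ℂ 2 (volume : Measure (EuclideanSpace ℝ (Fin d)))) ξ‖ₑ ^ 2 := by
  rw [← eLpNorm_fourier_toLp hg, eLpNorm_two_sq_eq_lintegral]
  have hw := (h.iterate_diffOp y r).congr_ae (hf.iterate_diffOp y r).coeFn_toLp.symm hg.coeFn_toLp.symm
  refine lintegral_congr_ae ?_
  filter_upwards [fourier_eq_of_hasWeakDeriv hw, fourier_toLp_iterate_diffOp hf y r] with ξ h1 h2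
  rw [h1, h2, enorm_mul, enorm_mul, enorm_pow]
  ring

/-- The factor `|1 - exp(2πiua)|` vanishes for some steps `u`, but not on average. Once `T|a| ≥ 1`,
the oscillating part of the integral is at most `1/(π|a|) ≤ T/2`. -/
theorem le_lintegral_sub_exp {r : ℕ} {a T : ℝ} (hT : 0 < T) (ha : 1 ≤ T * |a|) :
    ENNReal.ofReal ((2 : ℝ)⁻¹ ^ r / 4 * T) ≤
      ∫⁻ u in Ioo 0 T, ‖1 - Complex.exp (2 * Real.pi * Complex.I * (u * a : ℝ))‖ₑ ^ (2 * r) := by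
  have ha0 : a ≠ 0 := by rintro rfl; simp at ha; linarith
  have hn : ∀ u : ℝ, ‖1 - Complex.exp (2 * Real.pi * Complex.I * (u * a : ℝ))‖ₑ ^ (2 * r) =
      ENNReal.ofReal ((2 - 2 * Real.cos (2 * Real.pi * a * u)) ^ r) := by
    intro u
    rw [← ofReal_norm, ← ENNReal.ofReal_pow (norm_nonneg _), pow_mul, Complex.sq_norm,
      show 2 * Real.pi * Complex.I * (u * a : ℝ) = ((2 * Real.pi * a * u : ℝ) : ℂ) * Complex.I by
        push_cast; ring, Complex.exp_mul_I]
    congr 2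
    rw [Complex.normSq_apply]
    simp only [← Complex.ofReal_cos, ← Complex.ofReal_sin, Complex.sub_re, Complex.add_re,
      Complex.one_re, Complex.ofReal_re, Complex.mul_re, Complex.ofReal_im, Complex.I_re, Complex.I_im,
      Complex.sub_im, Complex.one_im, Complex.add_im, Complex.mul_im]
    nlinarith [Real.sin_sq_add_cos_sq (2 * Real.pi * a * u)]
  have hnn : ∀ u : ℝ, 0 ≤ 2 - 2 * Real.cos (2 * Real.pi * a * u) := fun u => by
    linarith [Real.cos_le_one (2 * Real.pi * a * u)]
  simp only [hn]
  rw [← ofReal_integral_eq_lintegral_ofReal]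
  rotate_left
  · exact ((by fun_prop : Continuous fun u : ℝ => (2 - 2 * Real.cos (2 * Real.pi * a * u)) ^ r).integrableOn_Icc
      (a := 0) (b := T)).mono_set Ioo_subset_Icc_self
  · exact .of_forall fun u => pow_nonneg (hnn u) _
  refine ENNReal.ofReal_le_ofReal ?_
  rw [← integral_Ioc_eq_integral_Ioo, ← intervalIntegral.integral_of_le hT.le]
  -- With `x = 2 - 2cos ∈ [0,4]` this is `x^r ≥ 2^(-r)(x - 1/2)/4`: the right side is nonpositive
  -- for `x ≤ 1/2`, and at most `2^(-r)` otherwise. It reduces the `r`-th power to a linear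
  -- expression in the cosine.
  have hpt : ∀ u : ℝ, (2 : ℝ)⁻¹ ^ r / 4 * (3 / 2 - 2 * Real.cos (2 * Real.pi * a * u)) ≤
      (2 - 2 * Real.cos (2 * Real.pi * a * u)) ^ r := by
    intro u
    have h1 := Real.neg_one_le_cos (2 * Real.pi * a * u)
    have hp : (0 : ℝ) < 2⁻¹ ^ r := by positivity
    rcases le_total (2 - 2 * Real.cos (2 * Real.pi * a * u)) (1 / 2) with h | h
    · refine le_trans ?_ (pow_nonneg (hnn u) _)
      exact mul_nonpos_of_nonneg_of_nonpos (by positivity) (by linarith)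
    · calc _ ≤ (2 : ℝ)⁻¹ ^ r := by nlinarith
        _ ≤ _ := by gcongr; linarith
  have hsin : ∫ u in (0 : ℝ)..T, (2 : ℝ)⁻¹ ^ r / 4 * (3 / 2 - 2 * Real.cos (2 * Real.pi * a * u)) =
      (2 : ℝ)⁻¹ ^ r / 4 * (3 / 2 * T - 2 * ((2 * Real.pi * a)⁻¹ * Real.sin (2 * Real.pi * a * T))) := by
    have hne : 2 * Real.pi * a ≠ 0 := by positivity
    rw [intervalIntegral.integral_const_mul, intervalIntegral.integral_sub (by simp)
      (Continuous.intervalIntegrable (by fun_prop) _ _), intervalIntegral.integral_const_mul,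
      intervalIntegral.integral_comp_mul_left (fun x => Real.cos x) hne]
    simp only [intervalIntegral.integral_const, sub_zero, smul_eq_mul, mul_zero, integral_cos, Real.sin_zero]
    ring
  have hb : 2 * ((2 * Real.pi * a)⁻¹ * Real.sin (2 * Real.pi * a * T)) ≤ T / 2 := by
    refine (le_abs_self _).trans ?_
    rw [abs_mul, abs_mul, abs_inv, abs_mul, abs_mul, abs_two, abs_of_pos Real.pi_pos]
    have h1 := Real.abs_sin_le_one (2 * Real.pi * a * T)
    have h2 : (0 : ℝ) < |a| := abs_pos.2 ha0
    have h3 := Real.pi_gt_three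
    rw [inv_mul_eq_div, mul_div_assoc', div_le_iff₀ (by positivity)]
    nlinarith [mul_le_mul h3.le ha zero_le_one Real.pi_pos.le]
  calc _ ≤ (2 : ℝ)⁻¹ ^ r / 4 * (3 / 2 * T - 2 * ((2 * Real.pi * a)⁻¹ * Real.sin (2 * Real.pi * a * T))) := by
        gcongr; linarith
    _ = _ := hsin.symm
    _ ≤ _ := intervalIntegral.integral_mono hT.le (Continuous.intervalIntegrable (by fun_prop) _ _)
        (Continuous.intervalIntegrable (by fun_prop) _ _) hpt

theorem IsQuasiconcave.pos_of_monotoneOn {r : ℕ} {ω : ℝ → ℝ} (hω : IsQuasiconcave r ω)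
    (hmono : MonotoneOn ω (Ici 0)) {t : ℝ} (ht : 0 < t) : 0 < ω t := by
  rcases le_total t 1 with h | h
  · exact hω.pos t ⟨ht, h⟩
  · exact (hω.pos 1 ⟨one_pos, le_rfl⟩).trans_le (hmono (by simp) ht.le h)

theorem IsQuasiconcave.le_mul_pow {r : ℕ} {ω : ℝ → ℝ} (hω : IsQuasiconcave r ω)
    {A t : ℝ} (hA : 1 ≤ A) (ht : 0 < t) (h : A * t ≤ 1) : ω (A * t) ≤ A ^ r * ω t := by
  have h1 : t ≤ A * t := by nlinarith
  have := hω.monotoneOn_div ⟨ht, h1.trans h⟩ ⟨ht.trans_le h1, h⟩ h1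
  simp only at this
  rw [div_le_div_iff₀ (hω.pos _ ⟨ht, h1.trans h⟩) (hω.pos _ ⟨ht.trans_le h1, h⟩), mul_pow] at this
  have ht' : 0 < t ^ r := by positivity
  nlinarith

theorem IsQuasiconcave.exists_le_mul {r : ℕ} {ω : ℝ → ℝ} (hω : IsQuasiconcave r ω)
    (hmono : MonotoneOn ω (Ici 0)) {A : ℝ} (hA : 1 ≤ A) :
    ∃ C : ℝ, 0 < C ∧ ∀ t, 0 < t → t ≤ 1 → ω (A * t) ≤ C * ω t := by
  have hA0 : 0 < A := by linarith
  have p1 := hω.pos_of_monotoneOn hmono hA0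
  have p2 := hω.pos_of_monotoneOn hmono (inv_pos.2 hA0)
  -- The first summand serves `A * t ≤ 1`, where quasiconcavity applies; the second serves `t ≥
  -- A⁻¹`, where only monotonicity is left.
  refine ⟨A ^ r + ω A / ω A⁻¹, by positivity, fun t ht ht1 => ?_⟩
  have p3 := hω.pos_of_monotoneOn hmono ht
  rw [add_mul]
  rcases le_total (A * t) 1 with h | h
  · have := hω.le_mul_pow hA ht h
    have : 0 ≤ ω A / ω A⁻¹ * ω t := by positivity
    linarith
  · have h1 : A⁻¹ ≤ t := by rw [inv_le_iff_one_le_mul₀ hA0, mul_comm]; exact h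
    have h2 : ω (A * t) ≤ ω A := hmono (by simp; positivity) hA0.le (by nlinarith)
    have h3 : ω A⁻¹ ≤ ω t := hmono (inv_pos.2 hA0).le ht.le h1
    have h4 : ω A ≤ ω A / ω A⁻¹ * ω t := by
      rw [div_mul_eq_mul_div, le_div_iff₀ p2]; gcongr
    have : 0 ≤ A ^ r * ω t := by positivity
    linarith

theorem LipSpace.exists_eLpNorm_le {r l : ℕ} {ω : ℝ → ℝ} (hω : ∀ t, 0 < t → 0 < ω t)
    {f : EuclideanSpace ℝ (Fin d) → ℂ} (hf : f ∈ LipSpace d r l ω) :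
    ∃ C : ℝ≥0∞, C ≠ ∞ ∧ ∀ (h : EuclideanSpace ℝ (Fin d)) (t : ℝ) (α : Fin d → ℕ)
      (g : EuclideanSpace ℝ (Fin d) → ℂ), 0 < ‖h‖ → ‖h‖ < t → ∑ i, α i = l → HasWeakDeriv α f g →
      eLpNorm ((diffOp h)^[r] g) 2 volume ≤ C * ENNReal.ofReal (ω t) := by
  refine ⟨_, hf.2.ne, fun h t α g h0 ht hα hg => ?_⟩
  have ht0 : 0 < t := h0.trans ht
  rw [← ENNReal.div_le_iff_le_mul (.inl (by simpa using hω t ht0)) (.inl ENNReal.ofReal_ne_top)]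
  refine le_trans ?_ (le_iSup₂ (f := fun (t : ℝ) (_ : 0 < t) =>
    modulusOfSmoothness r l f t / ENNReal.ofReal (ω t)) t ht0)
  gcongr
  unfold modulusOfSmoothness
  refine le_trans ?_ (le_iSup _ h)
  refine le_trans ?_ (le_iSup _ ⟨h0, ht⟩)
  refine le_trans ?_ (le_iSup _ α)
  refine le_trans ?_ (le_iSup _ hα)
  refine le_trans ?_ (le_iSup _ g)
  exact le_iSup (fun _ : HasWeakDeriv α f g => eLpNorm ((diffOp h)^[r] g) 2 volume) hg

theorem derivSymbol_single (j : Fin d) (l : ℕ) (ξ : EuclideanSpace ℝ (Fin d)) :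
    derivSymbol (Pi.single j l) ξ = (2 * Real.pi * Complex.I * (ξ j : ℂ)) ^ l := by
  unfold derivSymbol
  rw [Finset.prod_eq_single j]
  · simp
  · intro i _ hij; simp [Pi.single_eq_of_ne hij]
  · simp

theorem enorm_pow_le_enorm_derivSymbol_single (j : Fin d) (l : ℕ) (ξ : EuclideanSpace ℝ (Fin d)) :
    ‖ξ j‖ₑ ^ l ≤ ‖derivSymbol (Pi.single j l) ξ‖ₑ := by
  rw [derivSymbol_single, enorm_pow]
  gcongr
  rw [← ofReal_norm, ← ofReal_norm]
  refine ENNReal.ofReal_le_ofReal ?_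
  simp only [norm_mul, Complex.norm_I, Complex.norm_real, Real.norm_eq_abs, Complex.norm_ofNat, mul_one, abs_of_pos Real.pi_pos]
  nlinarith [Real.pi_gt_three, abs_nonneg (ξ j)]

/-- The directional estimate behind the direct inequality. -/
theorem lintegral_coord_ge_le {r l : ℕ} {ω : ℝ → ℝ} (hω : ∀ t, 0 < t → 0 < ω t)
    {f : EuclideanSpace ℝ (Fin d) → ℂ} (hf2 : MemLp f 2 volume) (hf : f ∈ LipSpace d r l ω) :
    ∃ C : ℝ≥0∞, C ≠ ∞ ∧ ∀ (T : ℝ) (j : Fin d), 0 < T →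
      ∫⁻ ξ in {ξ : EuclideanSpace ℝ (Fin d) | 1 ≤ T * |ξ j|}, ‖ξ j‖ₑ ^ (2 * l) *
        ‖(𝓕 (hf2.toLp f) : Lp ℂ 2 (volume : Measure (EuclideanSpace ℝ (Fin d)))) ξ‖ₑ ^ 2 ≤
      C * ENNReal.ofReal (ω T) ^ 2 := by
  obtain ⟨C, hC, hb⟩ := LipSpace.exists_eLpNorm_le hω hf
  set c : ℝ := (2 : ℝ)⁻¹ ^ r / 4 with hc
  have hc0 : 0 < c := by positivity
  refine ⟨C ^ 2 * (ENNReal.ofReal c)⁻¹, ENNReal.mul_ne_top (by simp [hC]) (by simpa using hc0),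
    fun T j hT => ?_⟩
  set F : EuclideanSpace ℝ (Fin d) → ℂ := ⇑(𝓕 (hf2.toLp f) : Lp ℂ 2 (volume : Measure (EuclideanSpace ℝ (Fin d))))
    with hF
  have hFm : Measurable F := (Lp.stronglyMeasurable _).measurable
  obtain ⟨g, hg⟩ := hf.1 (Pi.single j l) (by simp)
  set S : Set (EuclideanSpace ℝ (Fin d)) := {ξ | 1 ≤ T * |ξ j|}
  have hS : MeasurableSet S := by
    refine measurableSet_le measurable_const ?_
    fun_prop
  let H : ℝ → EuclideanSpace ℝ (Fin d) → ℝ≥0∞ := fun u ξ =>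
    ‖1 - Complex.exp (2 * Real.pi * Complex.I * (u * ξ j : ℝ))‖ₑ ^ (2 * r) * (‖ξ j‖ₑ ^ (2 * l) * ‖F ξ‖ₑ ^ 2)
  have hHm : Measurable (Function.uncurry H) := by
    simp only [Function.uncurry_def, H]
    fun_prop
  have hup : ∀ u ∈ Ioo 0 T, ∫⁻ ξ, H u ξ ≤ C ^ 2 * ENNReal.ofReal (ω T) ^ 2 := by
    intro u hu
    have hn : ‖EuclideanSpace.single j u‖ = u := by simp [abs_of_pos hu.1]
    have hle := hb (EuclideanSpace.single j u) T _ g (by rw [hn]; exact hu.1) (by rw [hn]; exact hu.2)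
      (by simp) hg
    -- `g` itself need not be in `L²`; its difference is, because the Lipschitz bound makes the norm
    -- finite.
    have hmem : MemLp ((diffOp (EuclideanSpace.single j u))^[r] g) 2 volume :=
      ⟨(hg.iterate_diffOp _ r).locallyIntegrable_deriv.aestronglyMeasurable,
        hle.trans_lt (ENNReal.mul_lt_top hC.lt_top ENNReal.ofReal_lt_top)⟩
    calc ∫⁻ ξ, H u ξ ≤ eLpNorm ((diffOp (EuclideanSpace.single j u))^[r] g) 2 volume ^ 2 := by
          rw [eLpNorm_iterate_diffOp_sq hf2 hg _ r hmem]
          refine lintegral_mono fun ξ => ?_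
          have e : ⟪EuclideanSpace.single j u, ξ⟫ = u * ξ j := by
            simp [EuclideanSpace.inner_single_left]
          simp only [H, e]
          rw [pow_mul' ‖ξ j‖ₑ, ← mul_assoc]
          exact mul_le_mul_left (mul_le_mul_right
            (pow_le_pow_left' (enorm_pow_le_enorm_derivSymbol_single j l ξ) 2) _) _
      _ ≤ _ := by rw [← mul_pow]; gcongr
  -- Averaging over steps `u` along the `j`-th axis and Tonelli: the lower bound holds for each
  -- frequency in `S`, the upper bound for each step. The factor `T` then cancels.
  have h1 : ENNReal.ofReal (c * T) * ∫⁻ ξ in S, ‖ξ j‖ₑ ^ (2 * l) * ‖F ξ‖ₑ ^ 2 ≤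
      ENNReal.ofReal T * (C ^ 2 * ENNReal.ofReal (ω T) ^ 2) := by
    calc _ = ∫⁻ ξ in S, ENNReal.ofReal (c * T) * (‖ξ j‖ₑ ^ (2 * l) * ‖F ξ‖ₑ ^ 2) := by
          rw [lintegral_const_mul _ (by fun_prop)]
      _ ≤ ∫⁻ ξ in S, ∫⁻ u in Ioo 0 T, H u ξ := by
          refine setLIntegral_mono' hS fun ξ hξ => ?_
          simp only [H]
          rw [lintegral_mul_const _ (by fun_prop)]
          gcongr
          exact le_lintegral_sub_exp hT hξ
      _ ≤ ∫⁻ ξ, ∫⁻ u in Ioo 0 T, H u ξ := setLIntegral_le_lintegral _ _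
      _ = ∫⁻ u in Ioo 0 T, ∫⁻ ξ, H u ξ := by
          rw [lintegral_lintegral_swap]
          exact (hHm.comp measurable_swap).aemeasurable
      _ ≤ ∫⁻ u in Ioo 0 T, C ^ 2 * ENNReal.ofReal (ω T) ^ 2 := setLIntegral_mono' measurableSet_Ioo hup
      _ = _ := by simp [mul_comm]
  rw [ENNReal.ofReal_mul hc0.le, mul_comm (ENNReal.ofReal c), mul_assoc] at h1
  have h2 := (ENNReal.mul_le_mul_iff_right (by simpa using hT) ENNReal.ofReal_ne_top).1 h1
  rw [mul_right_comm, ← div_eq_mul_inv, ENNReal.le_div_iff_mul_le (.inl (by simpa using hc0)) (.inl ENNReal.ofReal_ne_top), mul_comm]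
  exact h2


theorem EuclideanSpace.exists_norm_le_sqrt_mul_abs (hd : 1 ≤ d) (ξ : EuclideanSpace ℝ (Fin d)) :
    ∃ j, ‖ξ‖ ≤ √d * |ξ j| := by
  have hd0 : (0 : ℝ) < d := by exact_mod_cast hd
  have : Nonempty (Fin d) := ⟨⟨0, hd⟩⟩
  obtain ⟨j, -, hj⟩ := Finset.exists_le_of_sum_le (s := (Finset.univ : Finset (Fin d)))
    (f := fun _ => ‖ξ‖ ^ 2 / d) (g := fun i => |ξ i| ^ 2) Finset.univ_nonempty (by
      rw [EuclideanSpace.norm_sq_eq]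
      simp [mul_div_cancel₀ _ hd0.ne'])
  refine ⟨j, ?_⟩
  rw [div_le_iff₀ hd0] at hj
  refine le_of_sq_le_sq ?_ (by positivity)
  rw [mul_pow, Real.sq_sqrt hd0.le]
  linarith

theorem exists_lintegral_tail_le (hd : 1 ≤ d) {r l : ℕ} {ω : ℝ → ℝ} (hω : IsQuasiconcave r ω)
    (hmono : MonotoneOn ω (Ici 0))
    {f : EuclideanSpace ℝ (Fin d) → ℂ} (hf2 : MemLp f 2 volume) (hf : f ∈ LipSpace d r l ω) :
    ∃ C : ℝ≥0∞, C ≠ ∞ ∧ ∀ n : ℕ, ∫⁻ ξ in {ξ : EuclideanSpace ℝ (Fin d) | 2 ^ n ≤ ‖ξ‖}, ‖ξ‖ₑ ^ (2 * l) *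
        ‖(𝓕 (hf2.toLp f) : Lp ℂ 2 (volume : Measure (EuclideanSpace ℝ (Fin d)))) ξ‖ₑ ^ 2 ≤
      C * ENNReal.ofReal (ω (2⁻¹ ^ n)) ^ 2 := by
  have hpos : ∀ t, 0 < t → 0 < ω t := fun t ht => hω.pos_of_monotoneOn hmono ht
  obtain ⟨C, hC, hb⟩ := lintegral_coord_ge_le hpos hf2 hf
  have hA : 1 ≤ √d := by rw [Real.one_le_sqrt]; exact_mod_cast hd
  obtain ⟨D, hD, hdbl⟩ := hω.exists_le_mul hmono hA
  refine ⟨d * (ENNReal.ofReal √d ^ (2 * l) * (C * ENNReal.ofReal D ^ 2)), ?_, fun n => ?_⟩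
  · exact ENNReal.mul_ne_top (by simp) (ENNReal.mul_ne_top (by simp) (ENNReal.mul_ne_top hC (by simp)))
  set F : EuclideanSpace ℝ (Fin d) → ℂ := ⇑(𝓕 (hf2.toLp f) : Lp ℂ 2 (volume : Measure (EuclideanSpace ℝ (Fin d))))
    with hF
  have hFm : Measurable F := (Lp.stronglyMeasurable _).measurable
  -- Some coordinate satisfies `‖ξ‖ ≤ √d |ξ j|`, so `2^n ≤ ‖ξ‖` gives `T |ξ j| ≥ 1`. The factor `√d`
  -- inside `ω` is removed at the end by `hdbl`.
  set T : ℝ := √d * 2⁻¹ ^ n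
  have hT : 0 < T := by positivity
  let S : Fin d → Set (EuclideanSpace ℝ (Fin d)) := fun j => {ξ | 1 ≤ T * |ξ j|} ∩ {ξ | ‖ξ‖ ≤ √d * |ξ j|}
  have hsub : {ξ : EuclideanSpace ℝ (Fin d) | 2 ^ n ≤ ‖ξ‖} ⊆ ⋃ j, S j := by
    intro ξ hξ
    obtain ⟨j, hj⟩ := EuclideanSpace.exists_norm_le_sqrt_mul_abs hd ξ
    refine mem_iUnion.2 ⟨j, ?_, hj⟩
    have h1 : (2 : ℝ) ^ n ≤ √d * |ξ j| := le_trans hξ hj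
    calc (1 : ℝ) = 2 ^ n * 2⁻¹ ^ n := by rw [← mul_pow]; simp
      _ ≤ √d * |ξ j| * 2⁻¹ ^ n := by gcongr
      _ = T * |ξ j| := by simp only [T]; ring
  have hSm : ∀ j, MeasurableSet (S j) := fun j => by
    refine (measurableSet_le measurable_const ?_).inter (measurableSet_le measurable_norm ?_) <;> fun_prop
  have hj : ∀ j, ∫⁻ ξ in S j, ‖ξ‖ₑ ^ (2 * l) * ‖F ξ‖ₑ ^ 2 ≤
      ENNReal.ofReal √d ^ (2 * l) * (C * ENNReal.ofReal (ω T) ^ 2) := by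
    intro j
    calc _ ≤ ∫⁻ ξ in S j, ENNReal.ofReal √d ^ (2 * l) * (‖ξ j‖ₑ ^ (2 * l) * ‖F ξ‖ₑ ^ 2) := by
          refine setLIntegral_mono' (hSm j) fun ξ hξ => ?_
          rw [← mul_assoc, ← mul_pow]
          gcongr
          rw [← ofReal_norm, ← ofReal_norm, ← ENNReal.ofReal_mul (by positivity)]
          exact ENNReal.ofReal_le_ofReal hξ.2
      _ = ENNReal.ofReal √d ^ (2 * l) * ∫⁻ ξ in S j, ‖ξ j‖ₑ ^ (2 * l) * ‖F ξ‖ₑ ^ 2 := by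
          rw [lintegral_const_mul _ (by fun_prop)]
      _ ≤ _ := by
          gcongr
          exact (lintegral_mono_set inter_subset_left).trans (hb T j hT)
  calc _ ≤ ∫⁻ ξ in ⋃ j, S j, ‖ξ‖ₑ ^ (2 * l) * ‖F ξ‖ₑ ^ 2 := lintegral_mono_set hsub
    _ ≤ ∑' j, ∫⁻ ξ in S j, ‖ξ‖ₑ ^ (2 * l) * ‖F ξ‖ₑ ^ 2 := lintegral_iUnion_le _ _
    _ ≤ ∑' j : Fin d, ENNReal.ofReal √d ^ (2 * l) * (C * ENNReal.ofReal (ω T) ^ 2) :=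
        ENNReal.tsum_le_tsum hj
    _ = d * (ENNReal.ofReal √d ^ (2 * l) * (C * ENNReal.ofReal (ω T) ^ 2)) := by
        rw [tsum_fintype]; simp
    _ ≤ d * (ENNReal.ofReal √d ^ (2 * l) * (C * (ENNReal.ofReal D * ENNReal.ofReal (ω (2⁻¹ ^ n))) ^ 2)) := by
        gcongr
        rw [← ENNReal.ofReal_mul hD.le]
        exact ENNReal.ofReal_le_ofReal (hdbl _ (by positivity) (pow_le_one₀ (by norm_num) (by norm_num)))
    _ = _ := by ring

end

/-! ### Dyadic shells and membership of the transform in `L^p`. -/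

noncomputable section

open scoped Pointwise

variable {d : ℕ}

/-- The dyadic shell `2 ^ k ≤ ‖ξ‖ < 2 ^ (k + 1)`. -/
def dyadicShell (d k : ℕ) : Set (EuclideanSpace ℝ (Fin d)) := {ξ | 2 ^ k ≤ ‖ξ‖ ∧ ‖ξ‖ < 2 ^ (k + 1)}

theorem measurableSet_dyadicShell (k : ℕ) : MeasurableSet (dyadicShell d k) :=
  (measurableSet_le measurable_const measurable_norm).inter
    (measurableSet_lt measurable_norm measurable_const)

theorem pairwise_disjoint_dyadicShell : Pairwise (Function.onFun Disjoint (dyadicShell d)) := by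
  have key : ∀ i j, i < j → Disjoint (dyadicShell d i) (dyadicShell d j) := by
    intro i j hij
    rw [Set.disjoint_left]
    rintro ξ ⟨-, h1⟩ ⟨h2, -⟩
    have : (2 : ℝ) ^ (i + 1) ≤ 2 ^ j := pow_le_pow_right₀ (by norm_num) hij
    linarith
  intro i j hij
  rcases hij.lt_or_gt with h | h
  · exact key i j h
  · exact (key j i h).symm

theorem iUnion_dyadicShell_add (n : ℕ) :
    ⋃ k, dyadicShell d (n + k) = {ξ : EuclideanSpace ℝ (Fin d) | 2 ^ n ≤ ‖ξ‖} := by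
  ext ξ
  simp only [mem_iUnion]
  constructor
  · rintro ⟨k, hk, -⟩
    exact (pow_le_pow_right₀ (by norm_num) (Nat.le_add_right n k)).trans hk
  · intro (h : (2 : ℝ) ^ n ≤ ‖ξ‖)
    have h1 : (1 : ℝ) ≤ ‖ξ‖ := (one_le_pow₀ (by norm_num)).trans h
    obtain ⟨m, hm, hm'⟩ := exists_nat_pow_near h1 (by norm_num : (1 : ℝ) < 2)
    have hnm : n ≤ m := by
      by_contra hlt
      have : (2 : ℝ) ^ (m + 1) ≤ 2 ^ n := pow_le_pow_right₀ (by norm_num) (by omega)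
      linarith
    exact ⟨m - n, by rw [Nat.add_sub_cancel' hnm]; exact ⟨hm, hm'⟩⟩

theorem exists_volume_dyadicShell (hd : 1 ≤ d) : ∃ v : ℝ≥0∞, v ≠ 0 ∧ v ≠ ∞ ∧
    ∀ k, volume (dyadicShell d k) = 2 ^ (k * d) * v := by
  refine ⟨volume (dyadicShell d 0), ?_, ?_, fun k => ?_⟩
  · have ho : IsOpen {ξ : EuclideanSpace ℝ (Fin d) | 1 < ‖ξ‖ ∧ ‖ξ‖ < 2} :=
      (isOpen_lt continuous_const continuous_norm).inter (isOpen_lt continuous_norm continuous_const)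
    have hne : {ξ : EuclideanSpace ℝ (Fin d) | 1 < ‖ξ‖ ∧ ‖ξ‖ < 2}.Nonempty :=
      ⟨EuclideanSpace.single ⟨0, hd⟩ (3 / 2), by norm_num⟩
    refine ((ho.measure_pos volume hne).trans_le (measure_mono ?_)).ne'
    rintro ξ ⟨h1, h2⟩
    exact ⟨by simpa using h1.le, by simpa using h2⟩
  · refine ((measure_mono ?_).trans_lt (measure_ball_lt_top (x := 0) (r := 2))).ne
    rintro ξ ⟨-, h2⟩
    simpa using h2
  · have : dyadicShell d k = (2 ^ k : ℝ) • dyadicShell d 0 := by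
      ext ξ
      rw [Set.mem_smul_set_iff_inv_smul_mem₀ (by positivity)]
      simp only [dyadicShell, mem_ofPred_eq, norm_smul, norm_inv, norm_pow, Real.norm_ofNat]
      rw [le_inv_mul_iff₀ (by positivity), inv_mul_lt_iff₀ (by positivity)]
      simp [pow_succ]
    rw [this, Measure.addHaar_smul]
    congr 1
    rw [finrank_euclideanSpace_fin, abs_of_pos (by positivity), ENNReal.ofReal_pow (by positivity),
      ENNReal.ofReal_pow (by norm_num), ENNReal.ofReal_ofNat, pow_mul]

theorem lintegral_rpow_enorm_le_of_le_two {p : ℝ} (hp0 : 0 < p) (hp2 : p ≤ 2)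
    {μ : Measure (EuclideanSpace ℝ (Fin d))}
    {F : EuclideanSpace ℝ (Fin d) → ℂ} (hF : AEStronglyMeasurable F μ) :
    ∫⁻ ξ, ‖F ξ‖ₑ ^ p ∂μ ≤ μ univ ^ (1 - p / 2) * (∫⁻ ξ, ‖F ξ‖ₑ ^ 2 ∂μ) ^ (p / 2) := by
  have h := ENNReal.rpow_le_rpow (eLpNorm'_le_eLpNorm'_mul_rpow_measure_univ hp0 hp2 hF) hp0.le
  rw [← lintegral_rpow_enorm_eq_rpow_eLpNorm' hp0, ENNReal.mul_rpow_of_nonneg _ _ hp0.le,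
    ← ENNReal.rpow_mul] at h
  refine h.trans_eq ?_
  rw [mul_comm, show (1 / p - 1 / 2) * p = 1 - p / 2 by field_simp]
  congr 1
  rw [eLpNorm', ← ENNReal.rpow_mul]
  simp only [ENNReal.rpow_ofNat]
  congr 1; ring

/-- Hölder on a set of measure `2^(kd) v` gives `2^(kd(1-p/2))`; extracting the weight `‖ξ‖^(2l) ≥
2^(2kl)` under the power `p/2` costs `2^(-klp)`. -/
theorem lintegral_dyadicShell_rpow_le (hd : 1 ≤ d) (l : ℕ) {p : ℝ} (hp0 : 0 < p) (hp2 : p < 2) :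
    ∃ C : ℝ≥0∞, C ≠ ∞ ∧ ∀ (F : EuclideanSpace ℝ (Fin d) → ℂ) (_ : Measurable F) (k : ℕ),
      ∫⁻ ξ in dyadicShell d k, ‖F ξ‖ₑ ^ p ≤ C * ((2 : ℝ≥0∞) ^ (k * (d * (1 - p / 2) - l * p)) *
        (∫⁻ ξ in dyadicShell d k, ‖ξ‖ₑ ^ (2 * l) * ‖F ξ‖ₑ ^ 2) ^ (p / 2)) := by
  obtain ⟨v, hv0, hv, hvol⟩ := exists_volume_dyadicShell hd
  have hp : 0 ≤ 1 - p / 2 := by linarith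
  refine ⟨v ^ (1 - p / 2), ENNReal.rpow_ne_top_of_nonneg hp hv, fun F hF k => ?_⟩
  have h2 : ∫⁻ ξ in dyadicShell d k, ‖F ξ‖ₑ ^ 2 ≤ (2 : ℝ≥0∞) ^ (-(k * (2 * l)) : ℝ) *
      ∫⁻ ξ in dyadicShell d k, ‖ξ‖ₑ ^ (2 * l) * ‖F ξ‖ₑ ^ 2 := by
    rw [← lintegral_const_mul _ (by fun_prop)]
    refine setLIntegral_mono' (measurableSet_dyadicShell k) fun ξ hξ => ?_
    rw [← mul_assoc]
    refine le_mul_of_one_le_left (by positivity) ?_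
    have : (2 : ℝ≥0∞) ^ (k * (2 * l)) ≤ ‖ξ‖ₑ ^ (2 * l) := by
      rw [pow_mul]
      gcongr
      have h2 : (2 : ℝ≥0∞) ^ k = ENNReal.ofReal (2 ^ k) := by
        rw [ENNReal.ofReal_pow (by norm_num), ENNReal.ofReal_ofNat]
      rw [← ofReal_norm, h2]
      exact ENNReal.ofReal_le_ofReal hξ.1
    calc (1 : ℝ≥0∞) = (2 : ℝ≥0∞) ^ (-(k * (2 * l)) : ℝ) * 2 ^ (k * (2 * l)) := by
          rw [← ENNReal.rpow_natCast, ← ENNReal.rpow_add _ _ (by norm_num) (by norm_num)]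
          push_cast; simp
      _ ≤ _ := by gcongr
  refine (lintegral_rpow_enorm_le_of_le_two hp0 hp2.le hF.aestronglyMeasurable).trans ?_
  rw [Measure.restrict_apply_univ, hvol]
  calc _ ≤ (2 ^ (k * d) * v) ^ (1 - p / 2) * ((2 : ℝ≥0∞) ^ (-(k * (2 * l)) : ℝ) *
      ∫⁻ ξ in dyadicShell d k, ‖ξ‖ₑ ^ (2 * l) * ‖F ξ‖ₑ ^ 2) ^ (p / 2) := by gcongr
    _ = _ := by
      rw [ENNReal.mul_rpow_of_nonneg _ _ hp, ENNReal.mul_rpow_of_nonneg _ _ (by positivity : 0 ≤ p / 2),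
        ← ENNReal.rpow_natCast, ← ENNReal.rpow_mul, ← ENNReal.rpow_mul,
        show (k * (d * (1 - p / 2) - l * p) : ℝ) = ((k * d : ℕ) : ℝ) * (1 - p / 2) + -(k * (2 * l)) * (p / 2) by
          push_cast; ring, ENNReal.rpow_add _ _ (by norm_num) (by norm_num)]
      ring

theorem tsum_lintegral_dyadicShell_add (n : ℕ) (G : EuclideanSpace ℝ (Fin d) → ℝ≥0∞) :
    ∑' k, ∫⁻ ξ in dyadicShell d (n + k), G ξ = ∫⁻ ξ in {ξ | 2 ^ n ≤ ‖ξ‖}, G ξ := by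
  rw [← iUnion_dyadicShell_add, lintegral_iUnion (fun k => measurableSet_dyadicShell _)]
  intro i j hij
  exact pairwise_disjoint_dyadicShell (by omega)

theorem lintegral_eq_ball_add_tsum_dyadicShell (G : EuclideanSpace ℝ (Fin d) → ℝ≥0∞) :
    ∫⁻ ξ, G ξ = (∫⁻ ξ in Metric.ball 0 1, G ξ) + ∑' k, ∫⁻ ξ in dyadicShell d k, G ξ := by
  have h := tsum_lintegral_dyadicShell_add 0 G
  simp only [zero_add, pow_zero] at h
  have : {ξ : EuclideanSpace ℝ (Fin d) | 1 ≤ ‖ξ‖} = (Metric.ball 0 1)ᶜ := by ext; simp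
  rw [h, this, lintegral_add_compl _ Metric.isOpen_ball.measurableSet]

theorem memLp_of_tsum_dyadicShell_lt_top (hd : 1 ≤ d) (l : ℕ) {p : ℝ} (hp0 : 0 < p) (hp2 : p < 2)
    {F : EuclideanSpace ℝ (Fin d) → ℂ} (hFm : Measurable F) (hF : MemLp F 2 volume)
    (h : ∑' k : ℕ, (2 : ℝ≥0∞) ^ (k * (d * (1 - p / 2) - l * p)) *
        (∫⁻ ξ in dyadicShell d k, ‖ξ‖ₑ ^ (2 * l) * ‖F ξ‖ₑ ^ 2) ^ (p / 2) < ∞) :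
    MemLp F (ENNReal.ofReal p) volume := by
  refine ⟨hF.1, ?_⟩
  rw [eLpNorm_lt_top_iff_lintegral_rpow_enorm_lt_top (by simpa using hp0) ENNReal.ofReal_ne_top,
    ENNReal.toReal_ofReal hp0.le, lintegral_eq_ball_add_tsum_dyadicShell]
  obtain ⟨C, hC, hle⟩ := lintegral_dyadicShell_rpow_le hd l hp0 hp2
  refine ENNReal.add_lt_top.2 ⟨?_, ?_⟩
  · refine (lintegral_rpow_enorm_le_of_le_two hp0 hp2.le hF.1.restrict).trans_lt ?_
    rw [Measure.restrict_apply_univ]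
    refine ENNReal.mul_lt_top (ENNReal.rpow_lt_top_of_nonneg (by linarith) measure_ball_lt_top.ne)
      (ENNReal.rpow_lt_top_of_nonneg (by positivity) ?_)
    refine ((setLIntegral_le_lintegral _ _).trans_lt ?_).ne
    rw [← eLpNorm_two_sq_eq_lintegral]
    exact ENNReal.pow_lt_top hF.2
  · refine (ENNReal.tsum_le_tsum (hle F hFm)).trans_lt ?_
    rw [ENNReal.tsum_mul_left]
    exact ENNReal.mul_lt_top hC.lt_top h

end

/-! ### Convergence of the energy series under each sufficient condition. -/

noncomputable section

theorem ENNReal.sum_rpow_le_card_rpow_mul {ι : Type*} (s : Finset ι) (a : ι → ℝ≥0∞) {q : ℝ}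
    (hq0 : 0 < q) (hq1 : q ≤ 1) :
    ∑ i ∈ s, a i ^ q ≤ (s.card : ℝ≥0∞) ^ (1 - q) * (∑ i ∈ s, a i) ^ q := by
  have h := ENNReal.rpow_le_rpow
    (ENNReal.rpow_sum_le_const_mul_sum_rpow s (fun i => a i ^ q) (one_le_inv_iff₀.2 ⟨hq0, hq1⟩)) hq0.le
  rw [← ENNReal.rpow_mul, inv_mul_cancel₀ hq0.ne', ENNReal.rpow_one,
    ENNReal.mul_rpow_of_nonneg _ _ hq0.le, ← ENNReal.rpow_mul, sub_mul, inv_mul_cancel₀ hq0.ne', one_mul] at h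
  simpa only [← ENNReal.rpow_mul, mul_inv_cancel₀ hq0.ne', ENNReal.rpow_one] using h

theorem sum_range_two_pow_eq {M : Type*} [AddCommMonoid M] (f : ℕ → M) (J : ℕ) :
    ∑ k ∈ Finset.range (2 ^ J), f k =
      f 0 + ∑ j ∈ Finset.range J, ∑ k ∈ Finset.Ico (2 ^ j) (2 ^ (j + 1)), f k := by
  induction J with
  | zero => simp
  | succ J ih =>
    rw [Finset.sum_range_succ, ← add_assoc, ← ih, Finset.range_eq_Ico, Finset.range_eq_Ico,
      Finset.sum_Ico_consecutive _ (Nat.zero_le _) (Nat.pow_le_pow_right (by norm_num) (Nat.le_succ J))]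

theorem ENNReal.tsum_eq_add_tsum_dyadic_le (f : ℕ → ℝ≥0∞) :
    ∑' k, f k ≤ f 0 + ∑' j, ∑ k ∈ Finset.Ico (2 ^ j) (2 ^ (j + 1)), f k := by
  refine ENNReal.tsum_le_of_sum_range_le fun n => ?_
  calc _ ≤ ∑ k ∈ Finset.range (2 ^ n), f k := by
        refine Finset.sum_le_sum_of_subset (Finset.range_mono ?_)
        exact Nat.lt_two_pow_self.le
    _ ≤ _ := by
      rw [sum_range_two_pow_eq]
      gcongr
      exact ENNReal.sum_le_tsum _

theorem tsum_lt_top_of_neg {τ q : ℝ} (hτ : τ < 0) (hq : 0 < q) {e : ℕ → ℝ≥0∞} {M : ℝ≥0∞} (hM : M ≠ ∞)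
    (he : ∀ n, e n ≤ M) : ∑' n : ℕ, (2 : ℝ≥0∞) ^ (n * τ) * e n ^ q < ∞ := by
  calc _ ≤ ∑' n : ℕ, ((2 : ℝ≥0∞) ^ τ) ^ n * M ^ q := by
        refine ENNReal.tsum_le_tsum fun n => ?_
        rw [mul_comm (n : ℝ), ENNReal.rpow_mul, ENNReal.rpow_natCast]
        gcongr
        exact he n
    _ < ∞ := by
        rw [ENNReal.tsum_mul_right, ENNReal.tsum_geometric]
        refine ENNReal.mul_lt_top ?_ (ENNReal.rpow_lt_top_of_nonneg hq.le hM)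
        rw [ENNReal.inv_lt_top, tsub_pos_iff_lt]
        exact ENNReal.rpow_lt_one_of_one_lt_of_neg (by norm_num) hτ

/-- The bound on single terms would give only the series of `(w n)^p`. The tail bound controls the
sum of a whole block of `2^j` energies by `(w (2^j))²`, and Hölder on the block gives `2^(j(1-p/2))
(w (2^j))^p`, the condensed form of the hypothesis. -/
theorem tsum_rpow_lt_top_of_tail {p : ℝ} (hp0 : 0 < p) (hp2 : p < 2) {w : ℕ → ℝ} (hw : ∀ n, 0 < w n)
    (hanti : Antitone w) (hsum : Summable fun n : ℕ => w n ^ p * ((n : ℝ) + 1) ^ (-(p / 2)))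
    {e : ℕ → ℝ≥0∞} {C : ℝ≥0∞} (hC : C ≠ ∞) (he : ∀ n, ∑' k, e (n + k) ≤ C * ENNReal.ofReal (w n) ^ 2) :
    ∑' n : ℕ, e n ^ (p / 2) < ∞ := by
  have hq : 0 < p / 2 := by positivity
  have hcond : Summable fun j : ℕ => (2 : ℝ) ^ j * (w (2 ^ j) ^ p * (((2 ^ j : ℕ) : ℝ) + 1) ^ (-(p / 2))) := by
    refine (summable_condensed_iff_of_nonneg (f := fun n : ℕ => w n ^ p * ((n : ℝ) + 1) ^ (-(p / 2)))
      (fun n => mul_nonneg (Real.rpow_nonneg (hw n).le _) (by positivity)) ?_).2 hsum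
    intro m n hm hmn
    have h1 : w n ^ p ≤ w m ^ p := Real.rpow_le_rpow (hw n).le (hanti hmn) hp0.le
    have h2 : ((n : ℝ) + 1) ^ (-(p / 2)) ≤ ((m : ℝ) + 1) ^ (-(p / 2)) :=
      Real.rpow_le_rpow_of_nonpos (by positivity) (by gcongr) (by linarith)
    have h3 := Real.rpow_nonneg (hw m).le p
    gcongr
  have hblock : ∀ j, ∑ k ∈ Finset.Ico (2 ^ j) (2 ^ (j + 1)), e k ^ (p / 2) ≤
      C ^ (p / 2) * ENNReal.ofReal (2 ^ (p / 2)) *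
        ENNReal.ofReal ((2 : ℝ) ^ j * (w (2 ^ j) ^ p * (((2 ^ j : ℕ) : ℝ) + 1) ^ (-(p / 2)))) := by
    intro j
    have htail : ∑ k ∈ Finset.Ico (2 ^ j) (2 ^ (j + 1)), e k ≤ C * ENNReal.ofReal (w (2 ^ j)) ^ 2 := by
      refine le_trans ?_ (he (2 ^ j))
      rw [Finset.sum_Ico_eq_sum_range]
      exact ENNReal.sum_le_tsum _
    refine (ENNReal.sum_rpow_le_card_rpow_mul _ _ hq (by linarith)).trans ?_
    have hcard : ((Finset.Ico (2 ^ j) (2 ^ (j + 1))).card : ℝ≥0∞) = ENNReal.ofReal (2 ^ j) := by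
      rw [Nat.card_Ico, pow_succ, mul_two, Nat.add_sub_cancel, ENNReal.ofReal_pow (by norm_num)]
      simp
    rw [hcard]
    calc _ ≤ ENNReal.ofReal (2 ^ j) ^ (1 - p / 2) * (C * ENNReal.ofReal (w (2 ^ j)) ^ 2) ^ (p / 2) := by gcongr
      _ = C ^ (p / 2) * ENNReal.ofReal ((2 ^ j : ℝ) ^ (1 - p / 2) * w (2 ^ j) ^ p) := by
        rw [ENNReal.mul_rpow_of_nonneg _ _ hq.le, ← ENNReal.rpow_ofNat, ← ENNReal.rpow_mul,
          show (2 : ℝ) * (p / 2) = p by ring, ENNReal.ofReal_rpow_of_pos (by positivity),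
          ENNReal.ofReal_rpow_of_pos (hw _), ENNReal.ofReal_mul (by positivity)]
        ring
      _ ≤ _ := by
        rw [mul_assoc, ← ENNReal.ofReal_mul (by positivity)]
        refine mul_le_mul_right (ENNReal.ofReal_le_ofReal ?_) _
        -- From `2^j + 1 ≤ 2 * 2^j`; this is the origin of the factor `2^(p/2)` in `hblock`.
        have h1 : (2 : ℝ) ^ (-(p / 2)) * (2 ^ j : ℝ) ^ (-(p / 2)) ≤ (((2 ^ j : ℕ) : ℝ) + 1) ^ (-(p / 2)) := by
          rw [← Real.mul_rpow (by norm_num) (by positivity)]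
          refine Real.rpow_le_rpow_of_nonpos (by positivity) ?_ (by linarith)
          have : (1 : ℝ) ≤ 2 ^ j := one_le_pow₀ (by norm_num)
          push_cast; linarith
        have h0 := Real.rpow_nonneg (hw (2 ^ j)).le p
        calc (2 ^ j : ℝ) ^ (1 - p / 2) * w (2 ^ j) ^ p
            = 2 ^ (p / 2) * (2 ^ j * (w (2 ^ j) ^ p * ((2 : ℝ) ^ (-(p / 2)) * (2 ^ j : ℝ) ^ (-(p / 2))))) := by
              rw [sub_eq_add_neg, Real.rpow_add (by positivity), Real.rpow_one,
                Real.rpow_neg (by norm_num : (0 : ℝ) ≤ 2)]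
              field_simp
          _ ≤ _ := by gcongr
  refine (ENNReal.tsum_eq_add_tsum_dyadic_le _).trans_lt (ENNReal.add_lt_top.2 ⟨?_, ?_⟩)
  · refine ENNReal.rpow_lt_top_of_nonneg hq.le (ne_top_of_le_ne_top ?_ ((ENNReal.le_tsum (f := fun k => e (0 + k)) 0).trans (he 0)))
    exact ENNReal.mul_ne_top hC (by simp)
  · refine (ENNReal.tsum_le_tsum hblock).trans_lt ?_
    rw [ENNReal.tsum_mul_left]
    refine ENNReal.mul_lt_top (ENNReal.mul_lt_top (ENNReal.rpow_lt_top_of_nonneg hq.le hC)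
      ENNReal.ofReal_lt_top) hcond.tsum_ofReal_lt_top

theorem tsum_mul_rpow_lt_top_of_le {p τ : ℝ} (hp0 : 0 < p) {w : ℕ → ℝ} (hw : ∀ n, 0 < w n)
    (hsum : Summable fun n : ℕ => w n ^ p * (2 : ℝ) ^ (n * τ))
    {e : ℕ → ℝ≥0∞} {C : ℝ≥0∞} (hC : C ≠ ∞) (he : ∀ n, e n ≤ C * ENNReal.ofReal (w n) ^ 2) :
    ∑' n : ℕ, (2 : ℝ≥0∞) ^ (n * τ) * e n ^ (p / 2) < ∞ := by
  have hq : 0 < p / 2 := by positivity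
  calc _ ≤ ∑' n : ℕ, C ^ (p / 2) * ENNReal.ofReal (w n ^ p * (2 : ℝ) ^ (n * τ)) := by
        refine ENNReal.tsum_le_tsum fun n => ?_
        calc _ ≤ (2 : ℝ≥0∞) ^ (n * τ) * (C * ENNReal.ofReal (w n) ^ 2) ^ (p / 2) := by gcongr; exact he n
          _ = _ := by
            rw [ENNReal.mul_rpow_of_nonneg _ _ hq.le, ← ENNReal.rpow_ofNat, ← ENNReal.rpow_mul,
              show (2 : ℝ) * (p / 2) = p by ring, ENNReal.ofReal_rpow_of_pos (hw _),
              ENNReal.ofReal_mul (Real.rpow_nonneg (hw n).le _),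
              ← ENNReal.ofReal_rpow_of_pos (by norm_num : (0 : ℝ) < 2), ENNReal.ofReal_ofNat]
            ring
    _ < ∞ := by
        rw [ENNReal.tsum_mul_left]
        exact ENNReal.mul_lt_top (ENNReal.rpow_lt_top_of_nonneg hq.le hC) hsum.tsum_ofReal_lt_top

end

/-! ### Admissible energies: the two harmonic examples and tools for Schur's test. -/

noncomputable section

/-- The energies `e k` of the dyadic shells are compatible with the modulus `w n = ω (2 ^ (-n))`. -/
def IsAdmissibleEnergy (R : ℝ) (w e : ℕ → ℝ) : Prop :=
  (∀ k, 0 ≤ e k) ∧ ∃ C, ∀ n N, ∑ k ∈ Finset.range N, min 1 (R ^ k / R ^ n) * e k ≤ C * w n ^ 2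

theorem summable_add_one_rpow_neg {a : ℝ} (ha : 1 < a) :
    Summable fun k : ℕ => ((k : ℝ) + 1) ^ (-a) := by
  have := (summable_nat_add_iff 1).2 (Real.summable_nat_rpow.2 (by linarith : -a < -1))
  simpa using this

theorem not_summable_of_inv_add_one_le {f : ℕ → ℝ} (h : ∀ k : ℕ, ((k : ℝ) + 1)⁻¹ ≤ f k) : ¬Summable f := by
  intro hf
  have h1 : Summable fun k : ℕ => ((k : ℝ) + 1)⁻¹ := hf.of_nonneg_of_le (fun k => by positivity) h
  have h2 : Summable fun k : ℕ => ((k + 1 : ℕ) : ℝ)⁻¹ := by simpa using h1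
  exact Real.not_summable_natCast_inv ((summable_nat_add_iff 1).1 h2)

/-- With `w` bounded below, admissibility asks only for a summable energy. The choice `(k+1)^(-2/p)`
is summable since `2/p > 1`, while its power `p/2` is harmonic. -/
theorem exists_energy_of_pos_le {R p τ c : ℝ} (hp0 : 0 < p) (hp2 : p < 2) (hτ : 0 ≤ τ) {w : ℕ → ℝ}
    (hc : 0 < c) (hw : ∀ n, c ≤ w n) :
    ∃ e : ℕ → ℝ, IsAdmissibleEnergy R w e ∧ ¬Summable fun n : ℕ => (2 : ℝ) ^ (n * τ) * e n ^ (p / 2) := by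
  have hsum := summable_add_one_rpow_neg (a := 2 / p) (by rw [lt_div_iff₀ hp0]; linarith)
  set S := ∑' k : ℕ, ((k : ℝ) + 1) ^ (-(2 / p))
  have hS : 0 ≤ S := tsum_nonneg fun k => by positivity
  refine ⟨fun k => ((k : ℝ) + 1) ^ (-(2 / p)), ⟨fun k => by positivity, S / c ^ 2, fun n N => ?_⟩,
    not_summable_of_inv_add_one_le fun k => ?_⟩
  · calc _ ≤ ∑ k ∈ Finset.range N, ((k : ℝ) + 1) ^ (-(2 / p)) :=
          Finset.sum_le_sum fun k _ => mul_le_of_le_one_left (by positivity) (min_le_left _ _)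
      _ ≤ S := hsum.sum_le_tsum _ fun k _ => by positivity
      _ = S / c ^ 2 * c ^ 2 := by field_simp
      _ ≤ _ := by gcongr; exact hw n
  · dsimp only
    rw [← Real.rpow_mul (by positivity), show -(2 / p) * (p / 2) = -1 by field_simp, Real.rpow_neg_one]
    exact le_mul_of_one_le_left (by positivity) (Real.one_le_rpow (by norm_num) (by positivity))

/-- Doubling gives `w n ≥ 2^(-rn) w 0`, so only the branch `R^(k-n)` of the kernel matters, and
`4^(-rk)(k+1)^(-2/p)` is admissible. The weighted series dominates the harmonic one as soon as `τ ≥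
pr`. -/
theorem exists_energy_of_le {r : ℕ} {p τ : ℝ} (hp0 : 0 < p) (hp2 : p < 2) (hτ : p * r ≤ τ) {w : ℕ → ℝ}
    (hw : ∀ n, 0 < w n) (hdbl : ∀ n, w n ≤ 2 ^ r * w (n + 1)) :
    ∃ e : ℕ → ℝ, IsAdmissibleEnergy (4 ^ r) w e ∧
      ¬Summable fun n : ℕ => (2 : ℝ) ^ (n * τ) * e n ^ (p / 2) := by
  have hsum := summable_add_one_rpow_neg (a := 2 / p) (by rw [lt_div_iff₀ hp0]; linarith)
  set S := ∑' k : ℕ, ((k : ℝ) + 1) ^ (-(2 / p))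
  have hS : 0 ≤ S := tsum_nonneg fun k => by positivity
  have hw0 := hw 0
  have hlow : ∀ n, w 0 ≤ (2 ^ r) ^ n * w n := by
    intro n
    induction n with
    | zero => simp
    | succ n ih =>
      refine ih.trans ?_
      rw [pow_succ, mul_assoc]
      gcongr
      exact hdbl n
  have h4 : (4 : ℝ) ^ r = (2 ^ r) ^ 2 := by rw [← pow_mul, mul_comm, pow_mul]; norm_num
  refine ⟨fun k => ((4 : ℝ) ^ r)⁻¹ ^ k * ((k : ℝ) + 1) ^ (-(2 / p)),
    ⟨fun k => by positivity, S / w 0 ^ 2, fun n N => ?_⟩,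
    not_summable_of_inv_add_one_le fun k => ?_⟩
  · have hk : ∀ k : ℕ, min 1 (((4 : ℝ) ^ r) ^ k / (4 ^ r) ^ n) * (((4 : ℝ) ^ r)⁻¹ ^ k * ((k : ℝ) + 1) ^ (-(2 / p))) ≤
        ((4 ^ r) ^ n)⁻¹ * ((k : ℝ) + 1) ^ (-(2 / p)) := by
      intro k
      calc _ ≤ (((4 : ℝ) ^ r) ^ k / (4 ^ r) ^ n) * (((4 : ℝ) ^ r)⁻¹ ^ k * ((k : ℝ) + 1) ^ (-(2 / p))) := by
            gcongr; exact min_le_right _ _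
        _ = _ := by rw [inv_pow]; field_simp
    calc _ ≤ ∑ k ∈ Finset.range N, ((4 ^ r) ^ n)⁻¹ * ((k : ℝ) + 1) ^ (-(2 / p)) :=
          Finset.sum_le_sum fun k _ => hk k
      _ = ((4 ^ r) ^ n)⁻¹ * ∑ k ∈ Finset.range N, ((k : ℝ) + 1) ^ (-(2 / p)) := by rw [Finset.mul_sum]
      _ ≤ ((4 ^ r) ^ n)⁻¹ * S := by
          gcongr
          exact hsum.sum_le_tsum _ fun k _ => by positivity
      _ = S / w 0 ^ 2 * (w 0 ^ 2 * ((4 ^ r) ^ n)⁻¹) := by field_simp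
      _ ≤ _ := by
          gcongr
          rw [← div_eq_mul_inv, div_le_iff₀ (by positivity), h4]
          calc w 0 ^ 2 ≤ ((2 ^ r) ^ n * w n) ^ 2 := by gcongr; exact hlow n
            _ = _ := by ring
  · have h2 : ((4 : ℝ) ^ r)⁻¹ ^ k = (2 : ℝ) ^ (-(2 * r * k : ℝ)) := by
      rw [h4, Real.rpow_neg (by norm_num), inv_pow]
      congr 1
      rw [← pow_mul, ← pow_mul, ← Real.rpow_natCast]
      congr 1; push_cast; ring
    dsimp only
    rw [Real.mul_rpow (by positivity) (by positivity), ← Real.rpow_mul (by positivity),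
      show -(2 / p) * (p / 2) = -1 by field_simp, Real.rpow_neg_one, h2, ← Real.rpow_mul (by norm_num),
      ← mul_assoc, ← Real.rpow_add (by norm_num)]
    refine le_mul_of_one_le_left (by positivity) (Real.one_le_rpow (by norm_num) ?_)
    have : 0 ≤ (k : ℝ) * (τ - p * r) := mul_nonneg (by positivity) (by linarith)
    linarith

theorem ENNReal.rpow_finsetSum_le {ι : Type*} (s : Finset ι) (a : ι → ℝ≥0∞) {q : ℝ}
    (hq0 : 0 < q) (hq1 : q ≤ 1) : (∑ i ∈ s, a i) ^ q ≤ ∑ i ∈ s, a i ^ q := by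
  classical
  induction s using Finset.induction_on with
  | empty => simp [hq0]
  | insert i s hi ih =>
    rw [Finset.sum_insert hi, Finset.sum_insert hi]
    exact (ENNReal.rpow_add_le_add_rpow _ _ hq0.le hq1).trans (by gcongr)

theorem ENNReal.ofReal_rpow_le_tsum_of_sum_le {q c : ℝ} (hq0 : 0 < q) (hq1 : q ≤ 1) {a : ℕ → ℝ}
    (ha : ∀ k, 0 ≤ a k) {N : ℕ} (h : c ≤ ∑ k ∈ Finset.range N, a k) :
    ENNReal.ofReal c ^ q ≤ ∑' k, ENNReal.ofReal (a k) ^ q := by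
  calc _ ≤ (∑ k ∈ Finset.range N, ENNReal.ofReal (a k)) ^ q := by
        rw [← ENNReal.ofReal_sum_of_nonneg fun k _ => ha k]
        exact ENNReal.rpow_le_rpow (ENNReal.ofReal_le_ofReal h) hq0.le
    _ ≤ _ := (ENNReal.rpow_finsetSum_le _ _ hq0 hq1).trans (ENNReal.sum_le_tsum _)

/-- Schur's test for nonnegative kernels on `ℓ¹`. -/
theorem ENNReal.tsum_lt_top_of_kernel {W E a b : ℕ → ℝ≥0∞} {K : ℕ → ℕ → ℝ≥0∞} {C : ℝ≥0∞} (hC : C ≠ ∞)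
    (hW : ∀ n, W n ≤ ∑' k, K n k * E k) (hK : ∀ k, ∑' n, a n * K n k ≤ C * b k)
    (hE : ∑' k, b k * E k < ∞) : ∑' n, a n * W n < ∞ := by
  calc _ ≤ ∑' n, ∑' k, a n * K n k * E k := by
        refine ENNReal.tsum_le_tsum fun n => ?_
        simp only [mul_assoc, ENNReal.tsum_mul_left]
        gcongr
        exact hW n
    _ = ∑' k, (∑' n, a n * K n k) * E k := by rw [ENNReal.tsum_comm]; simp only [ENNReal.tsum_mul_right]
    _ ≤ ∑' k, C * (b k * E k) := by
        refine ENNReal.tsum_le_tsum fun k => ?_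
        rw [← mul_assoc]
        gcongr
        exact hK k
    _ < ∞ := by
        rw [ENNReal.tsum_mul_left]
        exact ENNReal.mul_lt_top hC.lt_top hE

theorem summable_of_tsum_ofReal_lt_top {f : ℕ → ℝ} (hf : ∀ n, 0 ≤ f n)
    (h : ∑' n, ENNReal.ofReal (f n) < ∞) : Summable f := by
  have := ENNReal.summable_toReal h.ne
  simpa [ENNReal.toReal_ofReal (hf _)] using this

/-- Column bound for Schur's test: below `k` the growing series in `a` is dominated by its end,
above `k` the ratio is `a/b < 1`. Both parts are of order `a^k`. -/
theorem sum_pow_mul_le {a b : ℝ} (ha : 1 < a) (hab : a < b) {κ : ℕ → ℕ → ℝ}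
    (h1 : ∀ n k, κ n k ≤ 1) (hb : ∀ n k, κ n k ≤ b ^ k / b ^ n) (k M : ℕ) (h0 : ∀ n k, 0 ≤ κ n k) :
    ∑ n ∈ Finset.range M, a ^ n * κ n k ≤ (a / (a - 1) + (1 - a / b)⁻¹) * a ^ k := by
  have ha0 : 0 < a := by linarith
  have hb0 : 0 < b := by linarith
  have hlt : a / b < 1 := (div_lt_one hb0).2 hab
  calc _ ≤ ∑ n ∈ Finset.range (k + M), a ^ n * κ n k :=
        Finset.sum_le_sum_of_subset_of_nonneg (Finset.range_mono (by omega))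
          fun n _ _ => mul_nonneg (by positivity) (h0 n k)
    _ = ∑ n ∈ Finset.range k, a ^ n * κ n k + ∑ m ∈ Finset.range M, a ^ (k + m) * κ (k + m) k :=
        Finset.sum_range_add _ _ _
    _ ≤ ∑ n ∈ Finset.range k, a ^ n + ∑ m ∈ Finset.range M, a ^ k * (a / b) ^ m := by
        refine add_le_add (Finset.sum_le_sum fun n _ => ?_) (Finset.sum_le_sum fun m _ => ?_)
        · exact mul_le_of_le_one_right (by positivity) (h1 n k)
        · calc a ^ (k + m) * κ (k + m) k ≤ a ^ (k + m) * (b ^ k / b ^ (k + m)) := by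
                gcongr; exact hb _ _
            _ = _ := by rw [pow_add, pow_add, div_pow]; field_simp
    _ ≤ a / (a - 1) * a ^ k + (1 - a / b)⁻¹ * a ^ k := by
        refine add_le_add ?_ ?_
        · rw [geom_sum_eq ha.ne', div_mul_eq_mul_div]
          have : 0 ≤ a * a ^ k - a ^ k := by nlinarith [pow_pos ha0 k]
          gcongr
          linarith
        · rw [← Finset.mul_sum, mul_comm]
          gcongr
          rw [← tsum_geometric_of_lt_one (by positivity) hlt]
          exact (summable_geometric_of_lt_one (by positivity) hlt).sum_le_tsum _ fun _ _ => by positivity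
    _ = _ := by ring

end

/-! ### Energies from a concave majorant, for `l < s < l + r`. -/

noncomputable section

/-- The concave function `x ↦ inf_m w_m² (1 + R ^ m x)`, equivalent to `w_n²` at `x = R ^ (-n)`. -/
def concaveMajorant (R : ℝ) (w : ℕ → ℝ) (x : ℝ) : ℝ := ⨅ m, w m ^ 2 * (1 + R ^ m * x)

section concaveMajorant

variable {R : ℝ} {w : ℕ → ℝ}

theorem bddBelow_concaveMajorant (hR : 0 < R) {x : ℝ} (hx : 0 ≤ x) :
    BddBelow (range fun m => w m ^ 2 * (1 + R ^ m * x)) :=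
  ⟨0, by rintro _ ⟨m, rfl⟩; positivity⟩

theorem concaveOn_concaveMajorant (hR : 0 < R) : ConcaveOn ℝ (Ici 0) (concaveMajorant R w) := by
  refine ⟨convex_Ici 0, fun x hx y hy a b ha hb hab => le_ciInf fun m => ?_⟩
  have h1 := ciInf_le (bddBelow_concaveMajorant (w := w) hR hx) m
  have h2 := ciInf_le (bddBelow_concaveMajorant (w := w) hR hy) m
  simp only [smul_eq_mul]
  calc _ ≤ a * (w m ^ 2 * (1 + R ^ m * x)) + b * (w m ^ 2 * (1 + R ^ m * y)) := by
        gcongr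
        · exact h1
        · exact h2
    _ = (a + b) * w m ^ 2 + w m ^ 2 * R ^ m * (a * x + b * y) := by ring
    _ = _ := by rw [hab]; ring

theorem concaveMajorant_mono (hR : 0 < R) {x y : ℝ} (hx : 0 ≤ x) (hxy : x ≤ y) :
    concaveMajorant R w x ≤ concaveMajorant R w y :=
  ciInf_mono (bddBelow_concaveMajorant hR hx) fun m => by gcongr

theorem concaveMajorant_nonneg (hR : 0 < R) {x : ℝ} (hx : 0 ≤ x) : 0 ≤ concaveMajorant R w x :=
  Real.iInf_nonneg fun m => by positivity

theorem concaveMajorant_le (hR : 0 < R) (n : ℕ) : concaveMajorant R w (R ^ n)⁻¹ ≤ 2 * w n ^ 2 := by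
  refine (ciInf_le (bddBelow_concaveMajorant hR (by positivity)) n).trans_eq ?_
  field_simp
  ring

/-- Terms with `m ≤ n` are handled by monotonicity of `w`, those with `m ≥ n` by iterating the
doubling condition `m - n` times against `R^(m-n)`. -/
theorem le_concaveMajorant (hR : 0 < R) (hw : ∀ n, 0 < w n) (hanti : Antitone w)
    (hdbl : ∀ n, w n ^ 2 ≤ R * w (n + 1) ^ 2) (n : ℕ) :
    w n ^ 2 ≤ concaveMajorant R w (R ^ n)⁻¹ := by
  refine le_ciInf fun m => ?_
  rcases le_total m n with h | h
  · calc w n ^ 2 ≤ w m ^ 2 := pow_le_pow_left₀ (hw n).le (hanti h) 2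
      _ ≤ _ := le_mul_of_one_le_right (by positivity) (le_add_of_nonneg_right (by positivity))
  · obtain ⟨j, rfl⟩ := Nat.exists_eq_add_of_le h
    have key : w n ^ 2 ≤ R ^ j * w (n + j) ^ 2 := by
      clear h
      induction j with
      | zero => simp
      | succ j ih =>
        refine ih.trans ?_
        rw [pow_succ R, mul_assoc]
        gcongr
        exact hdbl _
    have : R ^ (n + j) * (R ^ n)⁻¹ = R ^ j := by rw [pow_add]; field_simp
    rw [this]
    nlinarith [sq_nonneg (w (n + j))]

/-- The slopes of the concave majorant between consecutive points `R ^ (-n)`. -/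
def majorantSlope (R : ℝ) (w : ℕ → ℝ) (n : ℕ) : ℝ :=
  (concaveMajorant R w (R ^ n)⁻¹ - concaveMajorant R w (R ^ (n + 1))⁻¹) / ((R ^ n)⁻¹ - (R ^ (n + 1))⁻¹)

/-- The increments of the slopes. -/
def majorantMass (R : ℝ) (w : ℕ → ℝ) (n : ℕ) : ℝ :=
  if n = 0 then majorantSlope R w 0 else majorantSlope R w n - majorantSlope R w (n - 1)

theorem inv_pow_succ_lt (hR : 1 < R) (n : ℕ) : (R ^ (n + 1))⁻¹ < (R ^ n)⁻¹ := by
  have : 0 < R := by linarith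
  exact inv_strictAnti₀ (by positivity) (pow_lt_pow_right₀ hR (Nat.lt_succ_self n))

theorem majorantSlope_nonneg (hR : 1 < R) (n : ℕ) : 0 ≤ majorantSlope R w n := by
  have h0 : 0 < R := by linarith
  have h := inv_pow_succ_lt hR n
  exact div_nonneg (sub_nonneg.2 (concaveMajorant_mono h0 (by positivity) h.le)) (by linarith)

theorem majorantMass_nonneg (hR : 1 < R) (n : ℕ) : 0 ≤ majorantMass R w n := by
  have h0 : 0 < R := by linarith
  unfold majorantMass
  split_ifs with h
  · exact majorantSlope_nonneg hR 0
  · obtain ⟨m, rfl⟩ := Nat.exists_eq_succ_of_ne_zero h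
    rw [sub_nonneg, Nat.succ_eq_add_one, Nat.add_sub_cancel]
    -- The points `R^(-n)` decrease, so concavity makes the slopes increase with `n`.
    exact (concaveOn_concaveMajorant (w := w) h0).slope_anti_adjacent (x := (R ^ (m + 1 + 1))⁻¹) (y := (R ^ (m + 1))⁻¹)
      (z := (R ^ m)⁻¹) (by simp; positivity) (by simp; positivity) (inv_pow_succ_lt hR _)
      (inv_pow_succ_lt hR _)

theorem sum_range_majorantMass (n : ℕ) :
    ∑ k ∈ Finset.range (n + 1), majorantMass R w k = majorantSlope R w n := by
  induction n with
  | zero => simp [majorantMass]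
  | succ n ih => rw [Finset.sum_range_succ, ih, majorantMass]; simp

theorem slope_mul_sub (hR : 1 < R) (n : ℕ) :
    majorantSlope R w n * ((R ^ n)⁻¹ - (R ^ (n + 1))⁻¹) =
      concaveMajorant R w (R ^ n)⁻¹ - concaveMajorant R w (R ^ (n + 1))⁻¹ :=
  div_mul_cancel₀ _ (sub_pos.2 (inv_pow_succ_lt hR n)).ne'

/-- The summand is `min(R^(-k), R^(-n))` times the mass, so this is the representation of a concave
function by functions `min(x, y)`, cut off at a finite stage. The masses with `k ≤ n` telescope to a
slope; the later ones are summed by parts. -/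
theorem sum_min_mul_majorantMass (hR : 1 < R) (n M : ℕ) :
    ∑ k ∈ Finset.range (n + M + 1), min 1 (R ^ k / R ^ n) * ((R ^ k)⁻¹ * majorantMass R w k) =
      concaveMajorant R w (R ^ n)⁻¹ - concaveMajorant R w (R ^ (n + M + 1))⁻¹ +
        (R ^ (n + M + 1))⁻¹ * majorantSlope R w (n + M) := by
  have h0 : 0 < R := by linarith
  induction M with
  | zero =>
    have : ∀ k ∈ Finset.range (n + 0 + 1), min 1 (R ^ k / R ^ n) * ((R ^ k)⁻¹ * majorantMass R w k) =
        (R ^ n)⁻¹ * majorantMass R w k := by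
      intro k hk
      rw [Finset.mem_range] at hk
      have hkn : R ^ k ≤ R ^ n := pow_le_pow_right₀ hR.le (by omega)
      rw [min_eq_right ((div_le_one (by positivity)).2 hkn)]
      field_simp
    rw [Finset.sum_congr rfl this, ← Finset.mul_sum, add_zero, sum_range_majorantMass]
    linarith [slope_mul_sub (w := w) hR n]
  | succ M ih =>
    rw [← add_assoc, Finset.sum_range_succ, ih]
    have hkn : R ^ n ≤ R ^ (n + M + 1) := pow_le_pow_right₀ hR.le (by omega)
    rw [min_eq_left ((one_le_div (by positivity)).2 hkn), majorantMass, if_neg (by omega),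
      Nat.add_sub_cancel]
    linarith [slope_mul_sub (w := w) hR (n + M + 1)]

end concaveMajorant

theorem exists_admissible_energy_ge {R : ℝ} (hR : 2 ≤ R) {w : ℕ → ℝ} (hw : ∀ n, 0 < w n) (hanti : Antitone w)
    (hdbl : ∀ n, w n ^ 2 ≤ R * w (n + 1) ^ 2) (hlim : ∀ ε > 0, ∃ n, w n < ε) :
    ∃ e : ℕ → ℝ, IsAdmissibleEnergy R w e ∧
      ∀ n, ∃ N, w n ^ 2 ≤ 2 * ∑ k ∈ Finset.range N, min 1 (R ^ k / R ^ n) * e k := by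
  have hR1 : 1 < R := by linarith
  have hR0 : 0 < R := by linarith
  have hnn : ∀ k, 0 ≤ (R ^ k)⁻¹ * majorantMass R w k := fun k =>
    mul_nonneg (by positivity) (majorantMass_nonneg hR1 k)
  -- The constant is `2 * 2`: since `R ≥ 2`, the boundary slope term costs at most one more value of
  -- the majorant, and the majorant is at most `2 (w n)²`.
  refine ⟨fun k => (R ^ k)⁻¹ * majorantMass R w k, ⟨hnn, 4, fun n N => ?_⟩, fun n => ?_⟩
  · calc _ ≤ ∑ k ∈ Finset.range (n + N + 1), min 1 (R ^ k / R ^ n) * ((R ^ k)⁻¹ * majorantMass R w k) :=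
          Finset.sum_le_sum_of_subset_of_nonneg (Finset.range_mono (by omega))
            fun k _ _ => mul_nonneg (by positivity) (hnn k)
      _ = _ := sum_min_mul_majorantMass hR1 n N
      _ ≤ 2 * concaveMajorant R w (R ^ n)⁻¹ := by
          have h1 := slope_mul_sub (w := w) hR1 (n + N)
          have h2 : (R ^ (n + N))⁻¹ = R * (R ^ (n + N + 1))⁻¹ := by rw [pow_succ]; field_simp
          have h3 : 0 ≤ (R ^ (n + N + 1))⁻¹ * majorantSlope R w (n + N) :=
            mul_nonneg (by positivity) (majorantSlope_nonneg hR1 _)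
          have h4 : (R ^ (n + N))⁻¹ ≤ (R ^ n)⁻¹ :=
            inv_anti₀ (by positivity) (pow_le_pow_right₀ hR1.le (by omega))
          have h5 := concaveMajorant_mono (w := w) hR0 (by positivity) h4
          have h6 := concaveMajorant_nonneg (w := w) (x := (R ^ (n + N + 1))⁻¹) hR0 (by positivity)
          rw [h2] at h1
          rw [h2] at h5
          nlinarith
      _ ≤ _ := by linarith [concaveMajorant_le (w := w) hR0 n]
  · have hΩ := le_concaveMajorant hR0 hw hanti hdbl n
    -- With this `m` the subtracted value of the majorant is at most `2 (w n / 2)²`, which leaves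
    -- half of `(w n)²`.
    obtain ⟨m, hm⟩ := hlim (w n / 2) (half_pos (hw n))
    refine ⟨n + m + 1, ?_⟩
    rw [sum_min_mul_majorantMass hR1 n m]
    have h1 := concaveMajorant_le (w := w) hR0 (n + m + 1)
    have h2 : w (n + m + 1) ≤ w m := hanti (by omega)
    have h3 : w (n + m + 1) ^ 2 ≤ (w n / 2) ^ 2 := pow_le_pow_left₀ (hw _).le (h2.trans hm.le) 2
    have h4 : 0 ≤ (R ^ (n + m + 1))⁻¹ * majorantSlope R w (n + m) :=
      mul_nonneg (by positivity) (majorantSlope_nonneg hR1 _)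
    linarith

theorem exists_energy_of_tendsto {r : ℕ} (hr : 1 ≤ r) {p τ : ℝ} (hp0 : 0 < p) (hp2 : p < 2) (hτ : 0 < τ)
    (hτr : τ < p * r) {w : ℕ → ℝ} (hw : ∀ n, 0 < w n) (hanti : Antitone w)
    (hdbl : ∀ n, w n ≤ 2 ^ r * w (n + 1)) (hlim : ∀ ε > 0, ∃ n, w n < ε)
    (hns : ¬Summable fun n : ℕ => w n ^ p * (2 : ℝ) ^ (n * τ)) :
    ∃ e : ℕ → ℝ, IsAdmissibleEnergy (4 ^ r) w e ∧
      ¬Summable fun n : ℕ => (2 : ℝ) ^ (n * τ) * e n ^ (p / 2) := by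
  have h4 : (4 : ℝ) ^ r = (2 ^ r) ^ 2 := by rw [← pow_mul, mul_comm, pow_mul]; norm_num
  have hR : (2 : ℝ) ≤ 4 ^ r := by
    calc (2 : ℝ) ≤ 4 ^ 1 := by norm_num
      _ ≤ 4 ^ r := pow_le_pow_right₀ (by norm_num) hr
  obtain ⟨e, he, hle⟩ := exists_admissible_energy_ge hR hw hanti (fun n => by
    rw [h4, ← mul_pow]; exact pow_le_pow_left₀ (hw n).le (hdbl n) 2) hlim
  refine ⟨e, he, fun hs => hns ?_⟩
  have hq : 0 < p / 2 := by positivity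
  set κ : ℕ → ℕ → ℝ := fun n k => min 1 (((4 : ℝ) ^ r) ^ k / (4 ^ r) ^ n)
  have hκ0 : ∀ n k, 0 ≤ κ n k := fun n k => by positivity
  have ha : 1 < (2 : ℝ) ^ τ := Real.one_lt_rpow (by norm_num) hτ
  -- This is `τ < pr`; together with `0 < τ` it makes the kernel `κ^(p/2)` bounded for the weights
  -- `2^(nτ)`.
  have hab : (2 : ℝ) ^ τ < (4 ^ r : ℝ) ^ (p / 2) := by
    rw [h4, ← Real.rpow_natCast, ← Real.rpow_natCast, ← Real.rpow_mul (by norm_num), ← Real.rpow_mul (by norm_num)]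
    refine Real.rpow_lt_rpow_of_exponent_lt (by norm_num) ?_
    push_cast; linarith
  have hpow : ∀ n : ℕ, (2 : ℝ) ^ (n * τ) = ((2 : ℝ) ^ τ) ^ n := fun n => by
    rw [mul_comm, Real.rpow_mul (by norm_num), Real.rpow_natCast]
  refine summable_of_tsum_ofReal_lt_top (fun n => mul_nonneg (Real.rpow_nonneg (hw n).le _) (by positivity)) ?_
  -- Since `p/2 ≤ 1`, the lower bound on the energies may be raised to the power `p/2` term by term;
  -- Schur's test then sums over `n`.
  have key := ENNReal.tsum_lt_top_of_kernel (W := fun n => ENNReal.ofReal (w n ^ 2 / 2) ^ (p / 2))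
    (E := fun k => ENNReal.ofReal (e k) ^ (p / 2)) (a := fun n => ENNReal.ofReal (((2 : ℝ) ^ τ) ^ n))
    (b := fun n => ENNReal.ofReal (((2 : ℝ) ^ τ) ^ n))
    (K := fun n k => ENNReal.ofReal (κ n k ^ (p / 2)))
    (C := ENNReal.ofReal ((2 : ℝ) ^ τ / ((2 : ℝ) ^ τ - 1) + (1 - (2 : ℝ) ^ τ / (4 ^ r : ℝ) ^ (p / 2))⁻¹))
    ENNReal.ofReal_ne_top ?_ ?_ ?_
  · have e1 : ∀ n : ℕ, ENNReal.ofReal (w n ^ p * (2 : ℝ) ^ (n * τ)) =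
        ENNReal.ofReal (2 ^ (p / 2)) * (ENNReal.ofReal (((2 : ℝ) ^ τ) ^ n) * ENNReal.ofReal (w n ^ 2 / 2) ^ (p / 2)) := by
      intro n
      have := hw n
      rw [ENNReal.ofReal_rpow_of_pos (by positivity), ← ENNReal.ofReal_mul (by positivity),
        ← ENNReal.ofReal_mul (by positivity), hpow, Real.div_rpow (by positivity) (by norm_num),
        ← Real.rpow_natCast (w n), ← Real.rpow_mul this.le]
      congr 1
      rw [show ((2 : ℕ) : ℝ) * (p / 2) = p by push_cast; ring]
      field_simp
    simp only [e1, ENNReal.tsum_mul_left]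
    exact ENNReal.mul_lt_top ENNReal.ofReal_lt_top key
  · intro n
    obtain ⟨N, hN⟩ := hle n
    refine (ENNReal.ofReal_rpow_le_tsum_of_sum_le hq (by linarith)
      (a := fun k => κ n k * e k) (fun k => mul_nonneg (hκ0 n k) (he.1 k)) (N := N) (by linarith)).trans_eq ?_
    refine tsum_congr fun k => ?_
    rw [ENNReal.ofReal_mul (hκ0 n k), ENNReal.mul_rpow_of_nonneg _ _ hq.le,
      ENNReal.ofReal_rpow_of_nonneg (hκ0 n k) hq.le]
  · intro k
    refine ENNReal.tsum_le_of_sum_range_le fun M => ?_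
    have hκq : ∀ n k, 0 ≤ κ n k ^ (p / 2) := fun n k => Real.rpow_nonneg (hκ0 n k) _
    have := sum_pow_mul_le ha hab (κ := fun n k => κ n k ^ (p / 2))
      (fun n k => Real.rpow_le_one (hκ0 n k) (min_le_left _ _) hq.le) (fun n k => ?_) k M hκq
    · rw [← ENNReal.ofReal_mul' (by positivity)]
      refine le_trans (le_of_eq ?_) (ENNReal.ofReal_le_ofReal this)
      rw [ENNReal.ofReal_sum_of_nonneg fun n _ => mul_nonneg (by positivity) (hκq n k)]
      exact Finset.sum_congr rfl fun n _ => (ENNReal.ofReal_mul (by positivity)).symm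
    · refine (Real.rpow_le_rpow (hκ0 n k) (min_le_right _ _) hq.le).trans_eq ?_
      rw [Real.div_rpow (by positivity) (by positivity), Real.rpow_pow_comm (by positivity),
        Real.rpow_pow_comm (by positivity)]
  · refine lt_of_eq_of_lt (tsum_congr fun k => ?_) hs.tsum_ofReal_lt_top
    rw [ENNReal.ofReal_rpow_of_nonneg (he.1 k) hq.le, ← ENNReal.ofReal_mul (by positivity), hpow]

end

/-! ### Energies spread over blocks, for the critical case `s = l`. -/

noncomputable section

/-- Energy spread evenly over the blocks `2 ^ j ≤ k < 2 ^ (j + 1)`. -/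
def blockEnergy (w : ℕ → ℝ) (k : ℕ) : ℝ :=
  if k = 0 then 0 else (w (2 ^ (Nat.log 2 k + 1)) ^ 2 - w (2 ^ (Nat.log 2 k + 2)) ^ 2) / 2 ^ Nat.log 2 k

section blockEnergy

variable {w : ℕ → ℝ}

theorem blockEnergy_eq {j k : ℕ} (hk : k ∈ Finset.Ico (2 ^ j) (2 ^ (j + 1))) :
    blockEnergy w k = (w (2 ^ (j + 1)) ^ 2 - w (2 ^ (j + 2)) ^ 2) / 2 ^ j := by
  rw [Finset.mem_Ico] at hk
  have hk0 : k ≠ 0 := by have := Nat.two_pow_pos j; omega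
  have : Nat.log 2 k = j := (Nat.log_eq_iff (.inr ⟨by norm_num, hk0⟩)).2 hk
  rw [blockEnergy, if_neg hk0, this]

theorem sq_sub_sq_nonneg (hw : ∀ n, 0 < w n) (hanti : Antitone w) {m n : ℕ} (h : m ≤ n) :
    0 ≤ w m ^ 2 - w n ^ 2 :=
  sub_nonneg.2 (pow_le_pow_left₀ (hw n).le (hanti h) 2)

theorem two_pow_le_two_pow_succ (j : ℕ) : 2 ^ j ≤ 2 ^ (j + 1) :=
  Nat.pow_le_pow_right (by norm_num) (Nat.le_succ j)

theorem blockEnergy_nonneg (hw : ∀ n, 0 < w n) (hanti : Antitone w) (k : ℕ) : 0 ≤ blockEnergy w k := by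
  unfold blockEnergy
  split_ifs
  · exact le_rfl
  · exact div_nonneg (sq_sub_sq_nonneg hw hanti (two_pow_le_two_pow_succ _)) (by positivity)

theorem sq_le_pow_mul_sq {R : ℝ} (hR : 0 < R) (hdbl : ∀ n, w n ^ 2 ≤ R * w (n + 1) ^ 2) (n j : ℕ) :
    w n ^ 2 ≤ R ^ j * w (n + j) ^ 2 := by
  induction j with
  | zero => simp
  | succ j ih =>
    refine ih.trans ?_
    rw [pow_succ R, mul_assoc]
    gcongr
    exact hdbl _

/-- If `n` precedes the end of the block, the kernel is at most `1` and the block carries exactly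
one decrement of `w²`. If `n` lies beyond it, the geometric kernel beats the growth of `w²` allowed
by doubling, and division by the block length leaves `2^(-j)`. The minima with `(w n)²` turn the
first contribution into a telescoping sum that is valid in both cases. The index `2^(j+1)`, the end
of the block, is what keeps the decrement below `(w n)²` when `n` lies in the block. -/
theorem sum_block_min_mul_blockEnergy_le {R : ℝ} (hR : 2 ≤ R) (hw : ∀ n, 0 < w n) (hanti : Antitone w)
    (hdbl : ∀ n, w n ^ 2 ≤ R * w (n + 1) ^ 2) (n j : ℕ) :
    ∑ k ∈ Finset.Ico (2 ^ j) (2 ^ (j + 1)), min 1 (R ^ k / R ^ n) * blockEnergy w k ≤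
      (min (w n ^ 2) (w (2 ^ (j + 1)) ^ 2) - min (w n ^ 2) (w (2 ^ (j + 2)) ^ 2)) +
        w n ^ 2 * (1 / 2) ^ j := by
  have hR0 : 0 < R := by linarith
  set D := w (2 ^ (j + 1)) ^ 2 - w (2 ^ (j + 2)) ^ 2 with hD
  have hD0 : 0 ≤ D := sq_sub_sq_nonneg hw hanti (two_pow_le_two_pow_succ _)
  have hcongr : ∑ k ∈ Finset.Ico (2 ^ j) (2 ^ (j + 1)), min 1 (R ^ k / R ^ n) * blockEnergy w k =
      (∑ k ∈ Finset.Ico (2 ^ j) (2 ^ (j + 1)), min 1 (R ^ k / R ^ n)) * (D / 2 ^ j) := by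
    rw [Finset.sum_mul]
    exact Finset.sum_congr rfl fun k hk => by rw [blockEnergy_eq hk]
  rw [hcongr]
  have hw2 : ∀ {a b : ℕ}, a ≤ b → w b ^ 2 ≤ w a ^ 2 := fun h => pow_le_pow_left₀ (hw _).le (hanti h) 2
  rcases lt_or_ge n (2 ^ (j + 1)) with h | h
  · rw [min_eq_right (hw2 h.le), min_eq_right (hw2 (h.le.trans (two_pow_le_two_pow_succ _))), ← hD]
    have : (∑ k ∈ Finset.Ico (2 ^ j) (2 ^ (j + 1)), min 1 (R ^ k / R ^ n)) ≤ 2 ^ j := by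
      calc _ ≤ ∑ k ∈ Finset.Ico (2 ^ j) (2 ^ (j + 1)), (1 : ℝ) := Finset.sum_le_sum fun k _ => min_le_left _ _
        _ = _ := by simp [pow_succ, mul_two]
    calc _ ≤ 2 ^ j * (D / 2 ^ j) := by gcongr
      _ = D := by field_simp
      _ ≤ _ := le_add_of_nonneg_right (by positivity)
  · have h1 : (∑ k ∈ Finset.Ico (2 ^ j) (2 ^ (j + 1)), min 1 (R ^ k / R ^ n)) ≤ R ^ (2 ^ (j + 1)) / R ^ n := by
      calc _ ≤ ∑ k ∈ Finset.range (2 ^ (j + 1)), R ^ k / R ^ n := by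
            refine (Finset.sum_le_sum fun k _ => min_le_right _ _).trans
              (Finset.sum_le_sum_of_subset_of_nonneg ?_ fun k _ _ => by positivity)
            rw [Finset.range_eq_Ico]
            exact Finset.Ico_subset_Ico_left (Nat.zero_le _)
        _ = (∑ k ∈ Finset.range (2 ^ (j + 1)), R ^ k) / R ^ n := by rw [Finset.sum_div]
        _ ≤ _ := by
            gcongr
            rw [geom_sum_eq (by linarith), div_le_iff₀ (by linarith)]
            nlinarith [pow_pos hR0 (2 ^ (j + 1))]
    have h2 : D ≤ w (2 ^ (j + 1)) ^ 2 := by rw [hD]; linarith [sq_nonneg (w (2 ^ (j + 2)))]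
    have h3 : R ^ (2 ^ (j + 1)) / R ^ n * w (2 ^ (j + 1)) ^ 2 ≤ w n ^ 2 := by
      have := sq_le_pow_mul_sq hR0 hdbl (2 ^ (j + 1)) (n - 2 ^ (j + 1))
      rw [Nat.add_sub_cancel' h] at this
      rw [div_mul_eq_mul_div, div_le_iff₀ (by positivity)]
      calc _ ≤ R ^ (2 ^ (j + 1)) * (R ^ (n - 2 ^ (j + 1)) * w n ^ 2) := by gcongr
        _ = _ := by rw [← mul_assoc, ← pow_add, Nat.add_sub_cancel' h, mul_comm]
    have h4 : 0 ≤ min (w n ^ 2) (w (2 ^ (j + 1)) ^ 2) - min (w n ^ 2) (w (2 ^ (j + 2)) ^ 2) :=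
      sub_nonneg.2 (min_le_min le_rfl (hw2 (two_pow_le_two_pow_succ _)))
    calc _ ≤ R ^ (2 ^ (j + 1)) / R ^ n * (w (2 ^ (j + 1)) ^ 2 / 2 ^ j) := by gcongr
      _ = R ^ (2 ^ (j + 1)) / R ^ n * w (2 ^ (j + 1)) ^ 2 * (1 / 2) ^ j := by
          rw [one_div, inv_pow]; ring
      _ ≤ w n ^ 2 * (1 / 2) ^ j := by gcongr
      _ ≤ _ := le_add_of_nonneg_left h4

theorem isAdmissibleEnergy_blockEnergy {R : ℝ} (hR : 2 ≤ R) (hw : ∀ n, 0 < w n) (hanti : Antitone w)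
    (hdbl : ∀ n, w n ^ 2 ≤ R * w (n + 1) ^ 2) : IsAdmissibleEnergy R w (blockEnergy w) := by
  have hR0 : 0 < R := by linarith
  -- One from the telescoping sum, two from the geometric series.
  refine ⟨blockEnergy_nonneg hw hanti, 3, fun n N => ?_⟩
  calc _ ≤ ∑ k ∈ Finset.range (2 ^ N), min 1 (R ^ k / R ^ n) * blockEnergy w k :=
        Finset.sum_le_sum_of_subset_of_nonneg (Finset.range_mono Nat.lt_two_pow_self.le)
          fun k _ _ => mul_nonneg (by positivity) (blockEnergy_nonneg hw hanti k)
    _ ≤ ∑ j ∈ Finset.range N, ((min (w n ^ 2) (w (2 ^ (j + 1)) ^ 2) - min (w n ^ 2) (w (2 ^ (j + 1 + 1)) ^ 2)) +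
        w n ^ 2 * (1 / 2) ^ j) := by
        rw [sum_range_two_pow_eq]
        simp only [blockEnergy, if_true, mul_zero, zero_add]
        exact Finset.sum_le_sum fun j _ => sum_block_min_mul_blockEnergy_le hR hw hanti hdbl n j
    _ ≤ w n ^ 2 + w n ^ 2 * 2 := by
        rw [Finset.sum_add_distrib, Finset.sum_range_sub' (fun j => min (w n ^ 2) (w (2 ^ (j + 1)) ^ 2)),
          ← Finset.mul_sum]
        refine add_le_add ?_ ?_
        · have h1 : min (w n ^ 2) (w (2 ^ (0 + 1)) ^ 2) ≤ w n ^ 2 := min_le_left _ _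
          have h2 : 0 ≤ min (w n ^ 2) (w (2 ^ (N + 1)) ^ 2) := by positivity
          linarith
        · gcongr
          refine le_of_le_of_eq ?_ tsum_geometric_two
          exact summable_geometric_two.sum_le_tsum _ fun _ _ => by positivity
    _ = _ := by ring

end blockEnergy

theorem exists_energy_of_log {r : ℕ} (hr : 1 ≤ r) {p : ℝ} (hp0 : 0 < p) (hp2 : p < 2)
    {w : ℕ → ℝ} (hw : ∀ n, 0 < w n) (hanti : Antitone w)
    (hdbl : ∀ n, w n ≤ 2 ^ r * w (n + 1)) (hlim : ∀ ε > 0, ∃ n, w n < ε)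
    (hns : ¬Summable fun n : ℕ => w n ^ p * ((n : ℝ) + 1) ^ (-(p / 2))) :
    ∃ e : ℕ → ℝ, IsAdmissibleEnergy (4 ^ r) w e ∧ ¬Summable fun n : ℕ => e n ^ (p / 2) := by
  have h4 : (4 : ℝ) ^ r = (2 ^ r) ^ 2 := by rw [← pow_mul, mul_comm, pow_mul]; norm_num
  have hR : (2 : ℝ) ≤ 4 ^ r := by
    calc (2 : ℝ) ≤ 4 ^ 1 := by norm_num
      _ ≤ 4 ^ r := pow_le_pow_right₀ (by norm_num) hr
  refine ⟨blockEnergy w, isAdmissibleEnergy_blockEnergy hR hw hanti fun n => by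
    rw [h4, ← mul_pow]; exact pow_le_pow_left₀ (hw n).le (hdbl n) 2, fun hs => hns ?_⟩
  have hq : 0 < p / 2 := by positivity
  set D : ℕ → ℝ := fun j => w (2 ^ (j + 1)) ^ 2 - w (2 ^ (j + 2)) ^ 2
  have hD0 : ∀ j, 0 ≤ D j := fun j => sq_sub_sq_nonneg hw hanti (two_pow_le_two_pow_succ _)
  set a : ℝ := (2 : ℝ) ^ (1 - p / 2) with ha_def
  have ha : 1 < a := Real.one_lt_rpow (by norm_num) (by linarith)
  have hapow : ∀ j : ℕ, a ^ j = 2 ^ j * ((2 : ℝ) ^ j) ^ (-(p / 2)) := by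
    intro j
    rw [← Real.rpow_pow_comm (by norm_num), ← mul_pow, ha_def, sub_eq_add_neg, Real.rpow_add (by norm_num),
      Real.rpow_one]
  have hblock : ∀ j, ∑ k ∈ Finset.Ico (2 ^ j) (2 ^ (j + 1)), blockEnergy w k ^ (p / 2) = a ^ j * D j ^ (p / 2) := by
    intro j
    have hcard : 2 ^ (j + 1) - 2 ^ j = 2 ^ j := by rw [pow_succ, mul_two, Nat.add_sub_cancel]
    rw [Finset.sum_congr rfl (g := fun _ => (D j / 2 ^ j) ^ (p / 2)) fun k hk => by rw [blockEnergy_eq hk],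
      Finset.sum_const, Nat.card_Ico, hcard, nsmul_eq_mul, hapow, Real.div_rpow (hD0 j) (by positivity),
      Real.rpow_neg (by positivity)]
    push_cast
    ring
  have hE : Summable fun j : ℕ => a ^ j * D j ^ (p / 2) := by
    refine summable_of_sum_range_le (c := ∑' k, blockEnergy w k ^ (p / 2))
      (fun j => mul_nonneg (by positivity) (Real.rpow_nonneg (hD0 j) _)) fun J => ?_
    have h1 := sum_range_two_pow_eq (fun k => blockEnergy w k ^ (p / 2)) J
    have hnn : ∀ k, 0 ≤ blockEnergy w k ^ (p / 2) := fun k => Real.rpow_nonneg (blockEnergy_nonneg hw hanti k) _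
    have h2 := hs.sum_le_tsum (Finset.range (2 ^ J)) fun k _ => hnn k
    rw [h1, Finset.sum_congr rfl fun j _ => hblock j] at h2
    linarith [hnn 0]
  -- The decrements telescope from `m`; as `w` tends to `0`, finitely many of them recover half of
  -- `(w (2^(m+1)))²`.
  have hW : ∀ m, ∃ N, w (2 ^ (m + 1)) ^ 2 / 2 ≤ ∑ j ∈ Finset.range N, (if m ≤ j then 1 else 0) * D j := by
    intro m
    obtain ⟨n, hn⟩ := hlim (w (2 ^ (m + 1)) / 2) (half_pos (hw _))
    refine ⟨m + n, ?_⟩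
    have hsum : ∑ j ∈ Finset.range (m + n), (if m ≤ j then 1 else 0) * D j =
        w (2 ^ (m + 1)) ^ 2 - w (2 ^ (m + n + 1)) ^ 2 := by
      rw [Finset.sum_range_add, Finset.sum_eq_zero, zero_add]
      · rw [Finset.sum_congr rfl (g := fun i => w (2 ^ (m + i + 1)) ^ 2 - w (2 ^ (m + (i + 1) + 1)) ^ 2)
          fun i _ => by simp [D, add_assoc], Finset.sum_range_sub' (fun i => w (2 ^ (m + i + 1)) ^ 2)]
      · intro j hj
        rw [Finset.mem_range] at hj
        rw [if_neg (by omega), zero_mul]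
    rw [hsum]
    have h1 : n ≤ 2 ^ (m + n + 1) := by
      have := (Nat.lt_two_pow_self (n := m + n + 1)); omega
    have h2 : w (2 ^ (m + n + 1)) ^ 2 ≤ (w (2 ^ (m + 1)) / 2) ^ 2 :=
      pow_le_pow_left₀ (hw _).le ((hanti h1).trans hn.le) 2
    nlinarith [sq_nonneg (w (2 ^ (m + 1)))]
  -- The kernel is the indicator of `n ≤ k`; its columns sum to at most a constant times `a^k`
  -- because `a = 2^(1-p/2) > 1`.
  have key := ENNReal.tsum_lt_top_of_kernel (W := fun n => ENNReal.ofReal (w (2 ^ (n + 1)) ^ 2 / 2) ^ (p / 2))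
    (E := fun k => ENNReal.ofReal (D k) ^ (p / 2)) (a := fun n => ENNReal.ofReal (a ^ n))
    (b := fun n => ENNReal.ofReal (a ^ n))
    (K := fun n k => if n ≤ k then 1 else 0) (C := ENNReal.ofReal (a / (a - 1))) ENNReal.ofReal_ne_top ?_ ?_ ?_
  · have hcond : Summable fun j : ℕ => a ^ j * w (2 ^ j) ^ p := by
      rw [← summable_nat_add_iff 1]
      refine summable_of_tsum_ofReal_lt_top (fun j => mul_nonneg (by positivity) (Real.rpow_nonneg (hw _).le _)) ?_
      have e1 : ∀ j : ℕ, ENNReal.ofReal (a ^ (j + 1) * w (2 ^ (j + 1)) ^ p) = ENNReal.ofReal (a * 2 ^ (p / 2)) *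
          (ENNReal.ofReal (a ^ j) * ENNReal.ofReal (w (2 ^ (j + 1)) ^ 2 / 2) ^ (p / 2)) := by
        intro j
        have := hw (2 ^ (j + 1))
        rw [ENNReal.ofReal_rpow_of_pos (by positivity), ← ENNReal.ofReal_mul (by positivity),
          ← ENNReal.ofReal_mul (by positivity), Real.div_rpow (by positivity) (by norm_num),
          ← Real.rpow_natCast (w _) 2, ← Real.rpow_mul this.le]
        congr 1
        rw [show ((2 : ℕ) : ℝ) * (p / 2) = p by push_cast; ring]
        field_simp
        ring
      simp only [e1, ENNReal.tsum_mul_left]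
      exact ENNReal.mul_lt_top ENNReal.ofReal_lt_top key
    refine (summable_condensed_iff_of_nonneg (f := fun n : ℕ => w n ^ p * ((n : ℝ) + 1) ^ (-(p / 2)))
      (fun n => mul_nonneg (Real.rpow_nonneg (hw n).le _) (by positivity)) ?_).1 ?_
    · intro m n hm hmn
      have h1 : w n ^ p ≤ w m ^ p := Real.rpow_le_rpow (hw n).le (hanti hmn) hp0.le
      have h2 : ((n : ℝ) + 1) ^ (-(p / 2)) ≤ ((m : ℝ) + 1) ^ (-(p / 2)) :=
        Real.rpow_le_rpow_of_nonpos (by positivity) (by gcongr) (by linarith)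
      have h3 := Real.rpow_nonneg (hw m).le p
      gcongr
    · refine hcond.of_nonneg_of_le (fun j => mul_nonneg (by positivity)
        (mul_nonneg (Real.rpow_nonneg (hw _).le _) (by positivity))) fun j => ?_
      have h1 : (((2 ^ j : ℕ) : ℝ) + 1) ^ (-(p / 2)) ≤ ((2 : ℝ) ^ j) ^ (-(p / 2)) :=
        Real.rpow_le_rpow_of_nonpos (by positivity) (by push_cast; linarith) (by linarith)
      have h3 := Real.rpow_nonneg (hw (2 ^ j)).le p
      calc _ ≤ 2 ^ j * (w (2 ^ j) ^ p * ((2 : ℝ) ^ j) ^ (-(p / 2))) := by gcongr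
        _ = _ := by rw [hapow]; ring
  · intro m
    obtain ⟨N, hN⟩ := hW m
    refine (ENNReal.ofReal_rpow_le_tsum_of_sum_le hq (by linarith)
      (a := fun j => (if m ≤ j then 1 else 0) * D j) (fun j => by have := hD0 j; split_ifs <;> simp [this]) hN).trans_eq ?_
    refine tsum_congr fun k => ?_
    split_ifs <;> simp [hq]
  · intro k
    refine ENNReal.tsum_le_of_sum_range_le fun M => ?_
    rw [← ENNReal.ofReal_mul' (by positivity)]
    have h1 : ∀ n, ENNReal.ofReal (a ^ n) * (if n ≤ k then 1 else 0) = ENNReal.ofReal (a ^ n * if n ≤ k then 1 else 0) := by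
      intro n; split_ifs <;> simp
    rw [Finset.sum_congr rfl fun n _ => h1 n, ← ENNReal.ofReal_sum_of_nonneg fun n _ => by
      have : 0 < a := by linarith
      split_ifs <;> positivity]
    refine ENNReal.ofReal_le_ofReal ?_
    have ha0 : 0 < a := by linarith
    calc _ ≤ ∑ n ∈ Finset.range (k + 1), a ^ n := by
          simp only [mul_ite, mul_one, mul_zero]
          rw [← Finset.sum_filter]
          refine Finset.sum_le_sum_of_subset_of_nonneg ?_ fun n _ _ => by positivity
          intro n hn
          rw [Finset.mem_filter] at hn
          exact Finset.mem_range.2 (by omega)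
      _ ≤ _ := by
          rw [geom_sum_eq ha.ne', div_mul_eq_mul_div, pow_succ]
          have : 0 < a - 1 := by linarith
          gcongr
          linarith
  · refine lt_of_eq_of_lt (tsum_congr fun k => ?_) hE.tsum_ofReal_lt_top
    rw [ENNReal.ofReal_rpow_of_nonneg (hD0 k) hq.le, ← ENNReal.ofReal_mul (by positivity)]

end

/-! ### Discretization of the integral conditions. -/

noncomputable section

theorem iUnion_Ico_inv_two_pow : ⋃ n : ℕ, Ico ((2 : ℝ)⁻¹ ^ (n + 1)) (2⁻¹ ^ n) = Ioo 0 1 := by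
  ext t
  simp only [mem_iUnion, mem_Ico, mem_Ioo]
  constructor
  · rintro ⟨n, h1, h2⟩
    exact ⟨lt_of_lt_of_le (by positivity) h1, h2.trans_le (pow_le_one₀ (by norm_num) (by norm_num))⟩
  · rintro ⟨h0, h1⟩
    obtain ⟨n, hn, hn'⟩ := exists_nat_pow_near (one_le_inv_iff₀.2 ⟨h0, h1.le⟩) (by norm_num : (1 : ℝ) < 2)
    -- The intervals are closed on the left, so `t = 2^(-n)` belongs to the interval of index `n -
    -- 1`.
    by_cases hn1 : (2 : ℝ) ^ n = t⁻¹
    · have hn0 : n ≠ 0 := by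
        rintro rfl
        rw [pow_zero, eq_comm, inv_eq_one] at hn1
        linarith
      obtain ⟨m, rfl⟩ := Nat.exists_eq_succ_of_ne_zero hn0
      have ht : t = 2⁻¹ ^ (m + 1) := by rw [inv_pow, hn1, inv_inv]
      refine ⟨m, ht.ge, ?_⟩
      rw [ht, pow_succ]
      have : (0 : ℝ) < 2⁻¹ ^ m := by positivity
      linarith
    · refine ⟨n, ?_, ?_⟩
      · rw [inv_pow]; exact inv_le_of_inv_le₀ h0 hn'.le
      · rw [inv_pow, lt_inv_comm₀ h0 (by positivity)]
        exact lt_of_le_of_ne hn hn1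

theorem pairwise_disjoint_Ico_inv_two_pow :
    Pairwise (Function.onFun Disjoint fun n : ℕ => Ico ((2 : ℝ)⁻¹ ^ (n + 1)) (2⁻¹ ^ n)) := by
  have key : ∀ i j : ℕ, i < j → Disjoint (Ico ((2 : ℝ)⁻¹ ^ (i + 1)) (2⁻¹ ^ i)) (Ico ((2 : ℝ)⁻¹ ^ (j + 1)) (2⁻¹ ^ j)) := by
    intro i j hij
    rw [Set.disjoint_left]
    rintro t ⟨h1, -⟩ ⟨-, h2⟩
    have : (2 : ℝ)⁻¹ ^ j ≤ 2⁻¹ ^ (i + 1) := pow_le_pow_of_le_one (by norm_num) (by norm_num) hij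
    linarith
  intro i j hij
  rcases hij.lt_or_gt with h | h
  · exact key i j h
  · exact (key j i h).symm

/-- Discretization of a weighted integral of a power of a monotone function. -/
theorem lintegral_rpow_mul_lt_top_iff {p : ℝ} (hp : 0 < p) {ω : ℝ → ℝ} (hpos : ∀ t, 0 < t → 0 < ω t)
    (hmono : MonotoneOn ω (Ici 0)) {g q : ℝ → ℝ} {Q : ℕ → ℝ} {c C C' : ℝ} (hQ : ∀ n, 0 ≤ Q n) (hc : 0 < c)
    (hg : ∀ t ∈ Ioo (0 : ℝ) 1, g t = ω t ^ p * q t)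
    (hlow : ∀ n, ∀ t ∈ Ico ((2 : ℝ)⁻¹ ^ (n + 1)) (2⁻¹ ^ n), c * Q n ≤ 2⁻¹ ^ (n + 1) * q t)
    (hup : ∀ n, ∀ t ∈ Ico ((2 : ℝ)⁻¹ ^ (n + 1)) (2⁻¹ ^ n), 2⁻¹ ^ (n + 1) * q t ≤ C * Q n)
    (hQQ : ∀ n, Q (n + 1) ≤ C' * Q n) :
    ∫⁻ t in Ioo (0 : ℝ) 1, ENNReal.ofReal (g t) < ∞ ↔ Summable fun n : ℕ => ω (2⁻¹ ^ n) ^ p * Q n := by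
  have hw : ∀ n : ℕ, 0 ≤ ω (2⁻¹ ^ n) ^ p := fun n => Real.rpow_nonneg (hpos _ (by positivity)).le _
  have hsub : ∀ n : ℕ, Ico ((2 : ℝ)⁻¹ ^ (n + 1)) (2⁻¹ ^ n) ⊆ Ioo 0 1 := fun n => by
    rw [← iUnion_Ico_inv_two_pow]; exact subset_iUnion (fun n : ℕ => Ico ((2 : ℝ)⁻¹ ^ (n + 1)) (2⁻¹ ^ n)) n
  have hvol : ∀ n : ℕ, volume (Ico ((2 : ℝ)⁻¹ ^ (n + 1)) (2⁻¹ ^ n)) = ENNReal.ofReal (2⁻¹ ^ (n + 1)) := fun n => by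
    rw [Real.volume_Ico]; congr 1; rw [pow_succ]; ring
  have hsplit : ∫⁻ t in Ioo (0 : ℝ) 1, ENNReal.ofReal (g t) =
      ∑' n : ℕ, ∫⁻ t in Ico ((2 : ℝ)⁻¹ ^ (n + 1)) (2⁻¹ ^ n), ENNReal.ofReal (g t) := by
    rw [← iUnion_Ico_inv_two_pow, lintegral_iUnion (fun n => measurableSet_Ico) pairwise_disjoint_Ico_inv_two_pow]
  have hωt : ∀ n : ℕ, ∀ t ∈ Ico ((2 : ℝ)⁻¹ ^ (n + 1)) (2⁻¹ ^ n),
      ω (2⁻¹ ^ (n + 1)) ^ p ≤ ω t ^ p ∧ ω t ^ p ≤ ω (2⁻¹ ^ n) ^ p := by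
    intro n t ht
    have h0 : (0 : ℝ) < 2⁻¹ ^ (n + 1) := by positivity
    have ht0 : 0 < t := h0.trans_le ht.1
    exact ⟨Real.rpow_le_rpow (hpos _ h0).le (hmono h0.le ht0.le ht.1) hp.le,
      Real.rpow_le_rpow (hpos _ ht0).le (hmono ht0.le (mem_Ici.2 (by positivity)) ht.2.le) hp.le⟩
  have hq0 : ∀ n : ℕ, ∀ t ∈ Ico ((2 : ℝ)⁻¹ ^ (n + 1)) (2⁻¹ ^ n), 0 ≤ q t := by
    intro n t ht
    have h1 := (mul_nonneg hc.le (hQ n)).trans (hlow n t ht)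
    exact nonneg_of_mul_nonneg_right h1 (by positivity)
  rw [hsplit]
  constructor
  · intro h
    have hle : ∀ n : ℕ, ENNReal.ofReal (ω (2⁻¹ ^ (n + 1)) ^ p * (c * Q n)) ≤
        ∫⁻ t in Ico ((2 : ℝ)⁻¹ ^ (n + 1)) (2⁻¹ ^ n), ENNReal.ofReal (g t) := by
      intro n
      calc _ = ∫⁻ t in Ico ((2 : ℝ)⁻¹ ^ (n + 1)) (2⁻¹ ^ n),
            ENNReal.ofReal (ω (2⁻¹ ^ (n + 1)) ^ p * (c * Q n) / 2⁻¹ ^ (n + 1)) := by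
            rw [setLIntegral_const, hvol, ← ENNReal.ofReal_mul
              (div_nonneg (mul_nonneg (hw _) (mul_nonneg hc.le (hQ n))) (by positivity)),
              div_mul_cancel₀ _ (by positivity)]
        _ ≤ _ := by
            refine setLIntegral_mono' measurableSet_Ico fun t ht => ENNReal.ofReal_le_ofReal ?_
            rw [hg t (hsub n ht), div_le_iff₀ (by positivity), mul_assoc, mul_comm (q t)]
            exact mul_le_mul (hωt n t ht).1 (hlow n t ht) (mul_nonneg hc.le (hQ n)) ((hw _).trans (hωt n t ht).1)
    have h1 : Summable fun n : ℕ => ω (2⁻¹ ^ (n + 1)) ^ p * (c * Q n) :=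
      summable_of_tsum_ofReal_lt_top (fun n => mul_nonneg (hw _) (mul_nonneg hc.le (hQ n)))
        ((ENNReal.tsum_le_tsum hle).trans_lt h)
    -- The lower bound uses `ω` at the left endpoint `2^(-(n+1))`; `hQQ` pays for shifting the
    -- weight by one index.
    rw [← summable_nat_add_iff 1]
    refine (h1.mul_left (C' / c)).of_nonneg_of_le (fun n => mul_nonneg (hw _) (hQ _)) fun n => ?_
    calc _ ≤ ω (2⁻¹ ^ (n + 1)) ^ p * (C' * Q n) := mul_le_mul_of_nonneg_left (hQQ n) (hw _)
      _ = _ := by field_simp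
  · intro h
    have hle : ∀ n : ℕ, ∫⁻ t in Ico ((2 : ℝ)⁻¹ ^ (n + 1)) (2⁻¹ ^ n), ENNReal.ofReal (g t) ≤
        ENNReal.ofReal (C * (ω (2⁻¹ ^ n) ^ p * Q n)) := by
      intro n
      calc _ ≤ ∫⁻ t in Ico ((2 : ℝ)⁻¹ ^ (n + 1)) (2⁻¹ ^ n),
            ENNReal.ofReal (ω (2⁻¹ ^ n) ^ p * (C * Q n) / 2⁻¹ ^ (n + 1)) := by
            refine setLIntegral_mono' measurableSet_Ico fun t ht => ENNReal.ofReal_le_ofReal ?_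
            rw [hg t (hsub n ht), le_div_iff₀ (by positivity), mul_assoc, mul_comm (q t)]
            exact mul_le_mul (hωt n t ht).2 (hup n t ht) (mul_nonneg (by positivity) (hq0 n t ht)) (hw _)
        _ = _ := by
            rw [setLIntegral_const, hvol, ← ENNReal.ofReal_mul' (by positivity),
              div_mul_cancel₀ _ (by positivity)]
            congr 1; ring
    exact (ENNReal.tsum_le_tsum hle).trans_lt (h.mul_left C).tsum_ofReal_lt_top

theorem lintegral_rpow_weight_lt_top_iff {p a : ℝ} (hp : 0 < p) (ha : a < 0) {ω : ℝ → ℝ}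
    (hpos : ∀ t, 0 < t → 0 < ω t) (hmono : MonotoneOn ω (Ici 0)) :
    ∫⁻ t in Ioo (0 : ℝ) 1, ENNReal.ofReal (ω t ^ p * t ^ a / t) < ∞ ↔
      Summable fun n : ℕ => ω (2⁻¹ ^ n) ^ p * (2 : ℝ) ^ (n * -a) := by
  have h2 : ∀ n : ℕ, ((2 : ℝ)⁻¹ ^ n) ^ a = (2 : ℝ) ^ (n * -a) := by
    intro n
    rw [inv_pow, Real.inv_rpow (by positivity), ← Real.rpow_neg (by positivity), ← Real.rpow_natCast,
      ← Real.rpow_mul (by norm_num)]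
  refine lintegral_rpow_mul_lt_top_iff (q := fun t => t ^ a / t) (c := 1 / 2) (C := (2 : ℝ) ^ (-a))
    (C' := (2 : ℝ) ^ (-a)) hp hpos hmono (fun n => by positivity) (by norm_num) (fun t _ => by ring) ?_ ?_ ?_
  · intro n t ht
    have h0 : (0 : ℝ) < 2⁻¹ ^ (n + 1) := by positivity
    have ht0 : 0 < t := h0.trans_le ht.1
    rw [← h2, mul_div_assoc', le_div_iff₀ ht0]
    have h3 : ((2 : ℝ)⁻¹ ^ n) ^ a ≤ t ^ a := Real.rpow_le_rpow_of_nonpos ht0 ht.2.le ha.le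
    calc 1 / 2 * (2⁻¹ ^ n) ^ a * t ≤ 1 / 2 * t ^ a * 2⁻¹ ^ n := by
          have := ht.2.le
          gcongr
      _ = _ := by rw [pow_succ]; ring
  · intro n t ht
    have h0 : (0 : ℝ) < 2⁻¹ ^ (n + 1) := by positivity
    have ht0 : 0 < t := h0.trans_le ht.1
    have h3 : t ^ a ≤ ((2 : ℝ)⁻¹ ^ (n + 1)) ^ a := Real.rpow_le_rpow_of_nonpos h0 ht.1 ha.le
    rw [mul_div_assoc', div_le_iff₀ ht0]
    calc _ ≤ t * ((2 : ℝ)⁻¹ ^ (n + 1)) ^ a := by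
          have := ht.1
          gcongr
      _ = _ := by
          rw [h2, ← Real.rpow_add (by norm_num), mul_comm]
          congr 2; push_cast; ring
  · intro n
    rw [← Real.rpow_add (by norm_num)]
    refine le_of_eq ?_
    congr 1; push_cast; ring

/-- On the `n`-th dyadic interval `log (2/t)` lies between `(n+1) log 2` and `2(n+1)`. -/
theorem lintegral_log_weight_lt_top_iff {p : ℝ} (hp : 0 < p) {ω : ℝ → ℝ}
    (hpos : ∀ t, 0 < t → 0 < ω t) (hmono : MonotoneOn ω (Ici 0)) :
    ∫⁻ t in Ioo (0 : ℝ) 1, ENNReal.ofReal (ω t ^ p / Real.log (2 / t) ^ (p / 2) / t) < ∞ ↔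
      Summable fun n : ℕ => ω (2⁻¹ ^ n) ^ p * ((n : ℝ) + 1) ^ (-(p / 2)) := by
  have hl2 := Real.log_pos (by norm_num : (1 : ℝ) < 2)
  have hl2' : Real.log 2 ≤ 1 := by linarith [Real.log_two_lt_d9]
  have hlog : ∀ n : ℕ, Real.log (2 / 2⁻¹ ^ n) = (n + 1) * Real.log 2 := by
    intro n
    rw [inv_pow, div_inv_eq_mul, Real.log_mul (by norm_num) (by positivity), Real.log_pow]
    ring
  have hlogt : ∀ n : ℕ, ∀ t ∈ Ico ((2 : ℝ)⁻¹ ^ (n + 1)) (2⁻¹ ^ n),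
      ((n : ℝ) + 1) * Real.log 2 ≤ Real.log (2 / t) ∧ Real.log (2 / t) ≤ 2 * ((n : ℝ) + 1) := by
    intro n t ht
    have h0 : (0 : ℝ) < 2⁻¹ ^ (n + 1) := by positivity
    have ht0 : 0 < t := h0.trans_le ht.1
    constructor
    · rw [← hlog]
      refine Real.log_le_log (by positivity) ?_
      have := ht.2.le
      gcongr
    · calc Real.log (2 / t) ≤ Real.log (2 / 2⁻¹ ^ (n + 1)) := by
            refine Real.log_le_log (by positivity) ?_
            have := ht.1
            gcongr
        _ = ((n + 1 : ℕ) + 1) * Real.log 2 := hlog _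
        _ ≤ ((n + 1 : ℕ) + 1) * 1 := by gcongr
        _ ≤ _ := by push_cast; linarith
  refine lintegral_rpow_mul_lt_top_iff (q := fun t => (Real.log (2 / t)) ^ (-(p / 2)) / t)
    (c := 1 / 2 * (2 : ℝ) ^ (-(p / 2))) (C := Real.log 2 ^ (-(p / 2)))
    (C' := 1) hp hpos hmono (fun n => by positivity) (by positivity) ?_ ?_ ?_ ?_
  · intro t ht
    rw [Real.rpow_neg]
    · ring
    · refine Real.log_nonneg ?_
      rw [le_div_iff₀ ht.1]; linarith [ht.2]
  · intro n t ht
    have h0 : (0 : ℝ) < 2⁻¹ ^ (n + 1) := by positivity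
    have ht0 : 0 < t := h0.trans_le ht.1
    obtain ⟨h1, h2⟩ := hlogt n t ht
    rw [mul_div_assoc', le_div_iff₀ ht0]
    have h3 : (2 * ((n : ℝ) + 1)) ^ (-(p / 2)) ≤ Real.log (2 / t) ^ (-(p / 2)) :=
      Real.rpow_le_rpow_of_nonpos (lt_of_lt_of_le (by positivity) h1) h2 (by linarith)
    rw [Real.mul_rpow (by norm_num) (by positivity)] at h3
    calc _ = 1 / 2 * ((2 : ℝ) ^ (-(p / 2)) * ((n : ℝ) + 1) ^ (-(p / 2))) * t := by ring
      _ ≤ 1 / 2 * Real.log (2 / t) ^ (-(p / 2)) * 2⁻¹ ^ n := by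
          have := ht.2.le
          have h5 : 0 ≤ Real.log (2 / t) ^ (-(p / 2)) :=
            Real.rpow_nonneg (le_trans (by positivity) h1) _
          gcongr
      _ = _ := by rw [pow_succ]; ring
  · intro n t ht
    have h0 : (0 : ℝ) < 2⁻¹ ^ (n + 1) := by positivity
    have ht0 : 0 < t := h0.trans_le ht.1
    obtain ⟨h1, h2⟩ := hlogt n t ht
    have h3 : Real.log (2 / t) ^ (-(p / 2)) ≤ (((n : ℝ) + 1) * Real.log 2) ^ (-(p / 2)) :=
      Real.rpow_le_rpow_of_nonpos (by positivity) h1 (by linarith)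
    rw [Real.mul_rpow (by positivity) hl2.le] at h3
    rw [mul_div_assoc', div_le_iff₀ ht0]
    calc _ ≤ t * (((n : ℝ) + 1) ^ (-(p / 2)) * Real.log 2 ^ (-(p / 2))) := by
          have := ht.1
          have h5 : 0 ≤ Real.log (2 / t) ^ (-(p / 2)) :=
            Real.rpow_nonneg (le_trans (by positivity) h1) _
          gcongr
      _ = _ := by ring
  · intro n
    rw [one_mul]
    exact Real.rpow_le_rpow_of_nonpos (by positivity) (by push_cast; linarith) (by linarith)

end

/-! ### Functions constant on dyadic shells and bounds for the multipliers. -/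

noncomputable section

open scoped RealInnerProductSpace

variable {d : ℕ}

theorem Complex.enorm_real_eq (x : ℝ) : ‖(x : ℂ)‖ₑ = ‖x‖ₑ := by
  rw [← ofReal_norm, ← ofReal_norm, Complex.norm_real]

/-- The function equal to `c k` on the dyadic shell `2 ^ k ≤ ‖ξ‖ < 2 ^ (k + 1)`, and to `0` on the unit ball. -/
def shellFunction (d : ℕ) (c : ℕ → ℝ) (ξ : EuclideanSpace ℝ (Fin d)) : ℂ :=
  if ‖ξ‖ < 1 then 0 else (c (Nat.log 2 ⌊‖ξ‖⌋₊) : ℂ)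

theorem measurable_shellFunction (c : ℕ → ℝ) : Measurable (shellFunction d c) := by
  refine Measurable.ite (measurableSet_lt measurable_norm measurable_const) measurable_const ?_
  exact (measurable_from_nat (f := fun n : ℕ => (c (Nat.log 2 n) : ℂ))).comp
    (Nat.measurable_floor.comp measurable_norm)

theorem shellFunction_eq (c : ℕ → ℝ) {k : ℕ} {ξ : EuclideanSpace ℝ (Fin d)} (hξ : ξ ∈ dyadicShell d k) :
    shellFunction d c ξ = c k := by
  have h1 : (1 : ℝ) ≤ ‖ξ‖ := (one_le_pow₀ (by norm_num)).trans hξ.1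
  have hlog : Nat.log 2 ⌊‖ξ‖⌋₊ = k := by
    refine (Nat.log_eq_iff (.inr ⟨by norm_num, (Nat.floor_pos.2 h1).ne'⟩)).2 ⟨?_, ?_⟩
    · exact Nat.le_floor (by exact_mod_cast hξ.1)
    · exact (Nat.floor_lt (norm_nonneg _)).2 (by exact_mod_cast hξ.2)
  rw [shellFunction, if_neg (not_lt.2 h1), hlog]

theorem lintegral_mul_shellFunction_le (hd : 1 ≤ d) : ∃ v : ℝ≥0∞, v ≠ 0 ∧ v ≠ ∞ ∧
    (∀ (c : ℕ → ℝ) (p : ℝ), 0 < p → ∫⁻ ξ, ‖shellFunction d c ξ‖ₑ ^ p =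
      ∑' k : ℕ, ‖c k‖ₑ ^ p * (2 ^ (k * d) * v)) ∧
    ∀ (c : ℕ → ℝ) (G : EuclideanSpace ℝ (Fin d) → ℝ≥0∞) (b : ℕ → ℝ≥0∞),
      (∀ k, ∀ ξ ∈ dyadicShell d k, G ξ ≤ b k) →
      ∫⁻ ξ, G ξ * ‖shellFunction d c ξ‖ₑ ^ 2 ≤ ∑' k : ℕ, b k * ‖c k‖ₑ ^ 2 * (2 ^ (k * d) * v) := by
  obtain ⟨v, hv0, hv, hvol⟩ := exists_volume_dyadicShell hd
  have hball : ∀ (c : ℕ → ℝ), ∀ ξ ∈ Metric.ball (0 : EuclideanSpace ℝ (Fin d)) 1, shellFunction d c ξ = 0 := by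
    intro c ξ hξ
    rw [shellFunction, if_pos (by simpa using hξ)]
  refine ⟨v, hv0, hv, fun c p hp => ?_, fun c G b hG => ?_⟩
  · rw [lintegral_eq_ball_add_tsum_dyadicShell, setLIntegral_congr_fun (g := fun _ => 0)
      Metric.isOpen_ball.measurableSet fun ξ hξ => by simp [hball c ξ hξ, hp], lintegral_zero, zero_add]
    refine tsum_congr fun k => ?_
    rw [setLIntegral_congr_fun (g := fun _ => ‖c k‖ₑ ^ p) (measurableSet_dyadicShell k) fun ξ hξ => by
      simp [shellFunction_eq c hξ, Complex.enorm_real_eq], setLIntegral_const, hvol]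
  · rw [lintegral_eq_ball_add_tsum_dyadicShell, setLIntegral_congr_fun (g := fun _ => 0)
      Metric.isOpen_ball.measurableSet fun ξ hξ => by simp [hball c ξ hξ], lintegral_zero, zero_add]
    refine ENNReal.tsum_le_tsum fun k => ?_
    calc _ ≤ ∫⁻ ξ in dyadicShell d k, b k * ‖c k‖ₑ ^ 2 := by
          refine setLIntegral_mono' (measurableSet_dyadicShell k) fun ξ hξ => ?_
          rw [shellFunction_eq c hξ, Complex.enorm_real_eq]
          gcongr
          exact hG k ξ hξ
      _ = _ := by rw [setLIntegral_const, hvol]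

/-- The coefficients for which the `k`-th shell of `‖ξ‖ ^ (2 * l) * ‖F ξ‖ ^ 2` carries the energy `e k`. -/
def shellCoeff (d l : ℕ) (e : ℕ → ℝ) (k : ℕ) : ℝ := √(e k) * (2 : ℝ) ^ (-(k * (l + d / 2)) : ℝ)

theorem shellCoeff_sq (l : ℕ) {e : ℕ → ℝ} (he : ∀ k, 0 ≤ e k) (k : ℕ) :
    ‖shellCoeff d l e k‖ₑ ^ 2 * 2 ^ (k * d) * 2 ^ (2 * (k * l)) = ENNReal.ofReal (e k) := by
  have h0 : 0 ≤ shellCoeff d l e k := by unfold shellCoeff; positivity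
  have h2 : ∀ m : ℕ, (2 : ℝ≥0∞) ^ m = ENNReal.ofReal (2 ^ m) := fun m => by
    rw [ENNReal.ofReal_pow (by norm_num), ENNReal.ofReal_ofNat]
  rw [Real.enorm_of_nonneg h0, h2, h2, ← ENNReal.ofReal_pow h0, ← ENNReal.ofReal_mul (by positivity),
    ← ENNReal.ofReal_mul (by positivity)]
  congr 1
  rw [shellCoeff, mul_pow, Real.sq_sqrt (he k), mul_assoc, mul_assoc, ← Real.rpow_natCast _ 2, ← Real.rpow_mul (by norm_num),
    ← Real.rpow_natCast 2 (k * d), ← Real.rpow_natCast 2 (2 * (k * l)), ← Real.rpow_add (by norm_num), ← Real.rpow_add (by norm_num)]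
  have : (-(k * (l + d / 2)) : ℝ) * (2 : ℕ) + (((k * d : ℕ) : ℝ) + ((2 * (k * l) : ℕ) : ℝ)) = 0 := by
    push_cast; ring
  rw [this, Real.rpow_zero, mul_one]

theorem shellCoeff_rpow (l : ℕ) {e : ℕ → ℝ} (he : ∀ k, 0 ≤ e k) {p : ℝ} (hp : 0 < p) (k : ℕ) :
    ‖shellCoeff d l e k‖ₑ ^ p * 2 ^ (k * d) =
      ENNReal.ofReal ((2 : ℝ) ^ (k * (d * (1 - p / 2) - l * p)) * e k ^ (p / 2)) := by
  have h0 : 0 ≤ shellCoeff d l e k := by unfold shellCoeff; positivity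
  have h2 : ∀ m : ℕ, (2 : ℝ≥0∞) ^ m = ENNReal.ofReal (2 ^ m) := fun m => by
    rw [ENNReal.ofReal_pow (by norm_num), ENNReal.ofReal_ofNat]
  rw [Real.enorm_of_nonneg h0, h2, ENNReal.ofReal_rpow_of_nonneg h0 hp.le, ← ENNReal.ofReal_mul (by positivity)]
  congr 1
  rw [shellCoeff, Real.mul_rpow (by positivity) (by positivity), Real.sqrt_eq_rpow, ← Real.rpow_mul (he k),
    ← Real.rpow_mul (by norm_num), mul_assoc, ← Real.rpow_natCast, ← Real.rpow_add (by norm_num), mul_comm]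
  congr 2
  · push_cast; ring
  · ring

theorem enorm_derivSymbol_le (α : Fin d → ℕ) (ξ : EuclideanSpace ℝ (Fin d)) :
    ‖derivSymbol α ξ‖ₑ ≤ ENNReal.ofReal ((2 * Real.pi * ‖ξ‖) ^ (∑ i, α i)) := by
  rw [← ofReal_norm]
  refine ENNReal.ofReal_le_ofReal ?_
  rw [derivSymbol, norm_prod, ← Finset.prod_pow_eq_pow_sum]
  refine Finset.prod_le_prod (fun i _ => norm_nonneg _) fun i _ => ?_
  rw [norm_pow]
  gcongr
  simp only [norm_mul, Complex.norm_I, Complex.norm_real, Complex.norm_ofNat, mul_one, Real.norm_eq_abs,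
    abs_of_pos Real.pi_pos]
  gcongr
  exact PiLp.norm_apply_le ξ i

/-- The modulus is bounded both by `2` and by the phase `2π‖y‖‖ξ‖`. For `n = 0` the minimum equals
`1`, so no bound on `y` is needed; this covers large steps. -/
theorem enorm_one_sub_exp_pow_le {r k n : ℕ} {y ξ : EuclideanSpace ℝ (Fin d)} (hξ : ξ ∈ dyadicShell d k)
    (hy : n = 0 ∨ ‖y‖ ≤ 2⁻¹ ^ n) :
    ‖1 - Complex.exp (2 * Real.pi * Complex.I * ⟪y, ξ⟫)‖ₑ ^ (2 * r) ≤
      ENNReal.ofReal ((4 * Real.pi) ^ (2 * r) * min 1 (((4 : ℝ) ^ r) ^ k / (4 ^ r) ^ n)) := by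
  have hpi := Real.pi_gt_three
  have e0 : 2 * Real.pi * Complex.I * ⟪y, ξ⟫ = Complex.I * ((2 * Real.pi * ⟪y, ξ⟫ : ℝ) : ℂ) := by push_cast; ring
  have h2 : ‖1 - Complex.exp (2 * Real.pi * Complex.I * ⟪y, ξ⟫)‖ ≤ 2 := by
    refine (norm_sub_le _ _).trans ?_
    rw [e0, mul_comm Complex.I, Complex.norm_exp_ofReal_mul_I]
    norm_num
  have hmin : ‖1 - Complex.exp (2 * Real.pi * Complex.I * ⟪y, ξ⟫)‖ ≤ 4 * Real.pi * min 1 (2 ^ k / 2 ^ n) := by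
    rw [mul_min_of_nonneg _ _ (by positivity), mul_one]
    refine le_min (by linarith) ?_
    rcases hy with rfl | hy
    · have : (1 : ℝ) ≤ 2 ^ k := one_le_pow₀ (by norm_num)
      simp only [pow_zero, div_one]
      nlinarith
    · rw [e0, norm_sub_rev]
      refine Real.norm_exp_I_mul_ofReal_sub_one_le.trans ?_
      rw [Real.norm_eq_abs, abs_mul, abs_of_pos (by positivity)]
      calc 2 * Real.pi * |⟪y, ξ⟫| ≤ 2 * Real.pi * (‖y‖ * ‖ξ‖) := by
            gcongr; exact abs_real_inner_le_norm _ _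
        _ ≤ 2 * Real.pi * (2⁻¹ ^ n * 2 ^ (k + 1)) := by
            have := hξ.2.le
            gcongr
        _ = _ := by rw [inv_pow, pow_succ]; ring
  rw [← ofReal_norm, ← ENNReal.ofReal_pow (norm_nonneg _)]
  refine ENNReal.ofReal_le_ofReal ?_
  calc _ ≤ (4 * Real.pi * min 1 (2 ^ k / 2 ^ n)) ^ (2 * r) := by gcongr
    _ = (4 * Real.pi) ^ (2 * r) * min 1 (2 ^ k / 2 ^ n) ^ (2 * r) := mul_pow _ _ _
    _ ≤ _ := by
      gcongr
      refine le_min (pow_le_one₀ (by positivity) (min_le_left _ _)) ?_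
      refine (pow_le_pow_left₀ (by positivity) (min_le_right _ _) _).trans_eq ?_
      rw [div_pow, show (4 : ℝ) = 2 ^ 2 by norm_num]
      simp only [← pow_mul]
      congr 2 <;> ring

theorem tsum_ofReal_le_of_sum_range_le {a : ℕ → ℝ} {C : ℝ} (ha : ∀ k, 0 ≤ a k) (h : ∀ N, ∑ k ∈ Finset.range N, a k ≤ C) :
    ∑' k, ENNReal.ofReal (a k) ≤ ENNReal.ofReal C :=
  ENNReal.tsum_le_of_sum_range_le fun N => by
    rw [← ENNReal.ofReal_sum_of_nonneg fun k _ => ha k]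
    exact ENNReal.ofReal_le_ofReal (h N)

theorem enorm_derivSymbol_sq_le {α : Fin d → ℕ} {k l : ℕ} (hα : ∑ i, α i = l) {ξ : EuclideanSpace ℝ (Fin d)}
    (hξ : ξ ∈ dyadicShell d k) :
    ‖derivSymbol α ξ‖ₑ ^ 2 ≤ ENNReal.ofReal ((4 * Real.pi) ^ (2 * l)) * 2 ^ (2 * (k * l)) := by
  have h2 : ∀ m : ℕ, (2 : ℝ≥0∞) ^ m = ENNReal.ofReal (2 ^ m) := fun m => by
    rw [ENNReal.ofReal_pow (by norm_num), ENNReal.ofReal_ofNat]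
  refine (pow_le_pow_left' (enorm_derivSymbol_le α ξ) 2).trans ?_
  rw [hα, ← ENNReal.ofReal_pow (by positivity), h2, ← ENNReal.ofReal_mul (by positivity)]
  refine ENNReal.ofReal_le_ofReal ?_
  calc ((2 * Real.pi * ‖ξ‖) ^ l) ^ 2 ≤ ((2 * Real.pi * 2 ^ (k + 1)) ^ l) ^ 2 := by
        have := hξ.2.le
        gcongr
    _ = _ := by rw [show 2 * Real.pi * (2 : ℝ) ^ (k + 1) = 4 * Real.pi * 2 ^ k by rw [pow_succ]; ring]; ring

theorem measurable_derivSymbol (α : Fin d → ℕ) : Measurable (derivSymbol α) := by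
  unfold derivSymbol
  fun_prop

end

/-! ### Realisation of energies by functions, and the equivalence. -/

noncomputable section

open scoped RealInnerProductSpace

variable {d : ℕ}

theorem ENNReal.le_one_add_mul_of_sq_le {x K y : ℝ≥0∞} (h : x ^ 2 ≤ K * y ^ 2) :
    x ≤ (1 + K) * y := by
  by_contra hlt
  rw [not_le] at hlt
  have h1 : ((1 + K) * y) ^ 2 < x ^ 2 := ENNReal.pow_lt_pow_left two_ne_zero hlt
  have h2 : K * y ^ 2 ≤ ((1 + K) * y) ^ 2 := by
    rw [mul_pow]
    gcongr
    calc K ≤ 1 + K := le_add_self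
      _ = (1 + K) * 1 := (mul_one _).symm
      _ ≤ (1 + K) * (1 + K) := by gcongr; exact le_self_add
      _ = _ := (sq _).symm
  exact absurd (h1.trans_le (h.trans h2)) (lt_irrefl _)

/-- Take the inverse Fourier transform of the step function with shell energies `e k`. The
multiplier bounds turn admissibility at level `n` into a bound on differences with steps up to
`2^(-n)`, and constancy on shells makes the `p`-th power integral a multiple of the divergent
series. -/
theorem exists_mem_lipSpace_of_energy (hd : 1 ≤ d) {r l : ℕ} {p : ℝ} (hp0 : 0 < p) {ω : ℝ → ℝ}
    (hω : IsQuasiconcave r ω) (hmono : MonotoneOn ω (Ici 0)) {e : ℕ → ℝ}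
    (he : IsAdmissibleEnergy (4 ^ r) (fun n => ω (2⁻¹ ^ n)) e)
    (hns : ¬Summable fun k : ℕ => (2 : ℝ) ^ (k * (d * (1 - p / 2) - l * p)) * e k ^ (p / 2)) :
    ∃ f : EuclideanSpace ℝ (Fin d) → ℂ, f ∈ L2Space d ∩ LipSpace d r l ω ∧ f ∉ WienerSpace d p := by
  obtain ⟨he0, C, hC⟩ := he
  obtain ⟨v, hv0, hv, hint, hle⟩ := lintegral_mul_shellFunction_le hd
  set c := shellCoeff d l e with hc
  set F := shellFunction d c
  have hFm : Measurable F := measurable_shellFunction c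
  have hbound : ∀ (n : ℕ) (G : EuclideanSpace ℝ (Fin d) → ℝ≥0∞) (A : ℝ≥0∞),
      (∀ k, ∀ ξ ∈ dyadicShell d k, G ξ ≤ A * 2 ^ (2 * (k * l)) *
        ENNReal.ofReal (min 1 (((4 : ℝ) ^ r) ^ k / (4 ^ r) ^ n))) →
      ∫⁻ ξ, G ξ * ‖F ξ‖ₑ ^ 2 ≤ A * v * ENNReal.ofReal (C * ω (2⁻¹ ^ n) ^ 2) := by
    intro n G A hG
    refine (hle c G _ hG).trans ?_
    calc _ = ∑' k, A * v * ENNReal.ofReal (min 1 (((4 : ℝ) ^ r) ^ k / (4 ^ r) ^ n) * e k) := by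
          refine tsum_congr fun k => ?_
          rw [ENNReal.ofReal_mul (by positivity), ← shellCoeff_sq (d := d) l he0 k, ← hc]
          ring
      _ ≤ _ := by
          rw [ENNReal.tsum_mul_left]
          gcongr
          exact tsum_ofReal_le_of_sum_range_le (fun k => mul_nonneg (by positivity) (he0 k)) (hC n)
  have hmin0 : ∀ k : ℕ, min 1 (((4 : ℝ) ^ r) ^ k / (4 ^ r) ^ 0) = 1 := fun k => by
    rw [pow_zero, div_one]
    exact min_eq_left (one_le_pow₀ (one_le_pow₀ (by norm_num)))
  -- At level `n = 0` the kernel is `1`, so admissibility contains the summability of `e`; this also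
  -- gives `hV2`.
  have hF2 : MemLp F 2 volume := by
    refine ⟨hFm.aestronglyMeasurable, ?_⟩
    have h1 := hbound 0 (fun _ => 1) 1 fun k ξ _ => by
      rw [hmin0, ENNReal.ofReal_one, one_mul, mul_one]
      exact one_le_pow₀ (by norm_num)
    simp only [one_mul, ← eLpNorm_two_sq_eq_lintegral] at h1
    have h2 := h1.trans_lt (ENNReal.mul_lt_top hv.lt_top ENNReal.ofReal_lt_top)
    exact (ENNReal.pow_lt_top_iff.1 h2).resolve_right two_ne_zero
  set u : Lp ℂ 2 (volume : Measure (EuclideanSpace ℝ (Fin d))) := 𝓕⁻ (hF2.toLp F) with hu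
  have hFu : 𝓕 u = hF2.toLp F := fourier_fourierInv_eq _
  have hFf : (𝓕 ((Lp.memLp u).toLp u) : Lp ℂ 2 (volume : Measure (EuclideanSpace ℝ (Fin d)))) = hF2.toLp F := by
    rw [Lp.toLp_coeFn, hFu]
  have hV2 : ∀ α : Fin d → ℕ, ∑ i, α i = l → MemLp (fun ξ => derivSymbol α ξ * F ξ) 2 volume := by
    intro α hα
    refine ⟨((measurable_derivSymbol α).mul hFm).aestronglyMeasurable, ?_⟩
    have h1 := hbound 0 (fun ξ => ‖derivSymbol α ξ‖ₑ ^ 2) (ENNReal.ofReal ((4 * Real.pi) ^ (2 * l))) fun k ξ hξ => by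
      rw [hmin0, ENNReal.ofReal_one, mul_one]
      exact enorm_derivSymbol_sq_le hα hξ
    simp only [← mul_pow, ← enorm_mul, ← eLpNorm_two_sq_eq_lintegral] at h1
    have h2 := h1.trans_lt (ENNReal.mul_lt_top (ENNReal.mul_lt_top ENNReal.ofReal_lt_top hv.lt_top) ENNReal.ofReal_lt_top)
    exact (ENNReal.pow_lt_top_iff.1 h2).resolve_right two_ne_zero
  have hweak : ∀ (α : Fin d → ℕ) (hα : ∑ i, α i = l), HasWeakDeriv α u
      (𝓕⁻ ((hV2 α hα).toLp _) : Lp ℂ 2 (volume : Measure (EuclideanSpace ℝ (Fin d)))) := by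
    intro α hα
    refine hasWeakDeriv_of_fourier_eq α _ _ ?_
    rw [fourier_fourierInv_eq, hFu]
    filter_upwards [(hV2 α hα).coeFn_toLp, hF2.coeFn_toLp] with ξ h1 h2
    rw [h1, h2]
  have hmod : ∀ (n : ℕ) (y : EuclideanSpace ℝ (Fin d)) (α : Fin d → ℕ) (g : EuclideanSpace ℝ (Fin d) → ℂ),
      n = 0 ∨ ‖y‖ ≤ 2⁻¹ ^ n → ∑ i, α i = l → HasWeakDeriv α u g →
      eLpNorm ((diffOp y)^[r] g) 2 volume ^ 2 ≤
        ENNReal.ofReal ((4 * Real.pi) ^ (2 * r)) * ENNReal.ofReal ((4 * Real.pi) ^ (2 * l)) * v *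
          ENNReal.ofReal (C * ω (2⁻¹ ^ n) ^ 2) := by
    intro n y α g hy hα hg
    have hg2 : MemLp g 2 volume := (Lp.memLp _).ae_eq ((hweak α hα).ae_eq hg)
    rw [eLpNorm_iterate_diffOp_sq (Lp.memLp u) hg y r (hg2.iterate_diffOp y r), hFf]
    refine le_trans (le_of_eq ?_) (hbound n (fun ξ => ‖1 - Complex.exp (2 * Real.pi * Complex.I * ⟪y, ξ⟫)‖ₑ ^ (2 * r) *
      ‖derivSymbol α ξ‖ₑ ^ 2) _ fun k ξ hξ => ?_)
    · refine lintegral_congr_ae ?_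
      filter_upwards [hF2.coeFn_toLp] with ξ h1
      rw [h1]
    · have h1 := enorm_one_sub_exp_pow_le (r := r) hξ hy
      rw [ENNReal.ofReal_mul (by positivity)] at h1
      calc _ ≤ _ := mul_le_mul' h1 (enorm_derivSymbol_sq_le hα hξ)
        _ = _ := by ring
  refine ⟨u, ⟨Lp.memLp u, fun α hα => ⟨_, hweak α hα⟩, ?_⟩, ?_⟩
  · set K : ℝ≥0∞ := ENNReal.ofReal ((4 * Real.pi) ^ (2 * r)) * ENNReal.ofReal ((4 * Real.pi) ^ (2 * l)) * v *
      ENNReal.ofReal (C * (2 ^ r) ^ 2) with hK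
    have hKtop : K ≠ ∞ := ENNReal.mul_ne_top (ENNReal.mul_ne_top (ENNReal.mul_ne_top
      ENNReal.ofReal_ne_top ENNReal.ofReal_ne_top) hv) ENNReal.ofReal_ne_top
    have hC0 : 0 ≤ C := by
      have h1 := hC 0 0
      simp only [Finset.range_zero, Finset.sum_empty] at h1
      exact nonneg_of_mul_nonneg_left h1 (pow_pos (hω.pos_of_monotoneOn hmono (by norm_num)) 2)
    refine lt_of_le_of_lt (b := 1 + K) (iSup₂_le fun t ht => ?_) (by simpa using hKtop.lt_top)
    have hωt := hω.pos_of_monotoneOn hmono ht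
    refine ENNReal.div_le_of_le_mul ?_
    refine iSup_le fun y => iSup_le fun hy => iSup_le fun α => iSup_le fun hα => iSup_le fun g => iSup_le fun hg => ?_
    refine ENNReal.le_one_add_mul_of_sq_le ?_
    -- For `t ≤ 1` the dyadic level with `2^(-(n+1)) ≤ t ≤ 2^(-n)`, where doubling costs `2^r`; for
    -- `t ≥ 1` the level `0`, which allows arbitrary steps.
    obtain ⟨n, hn, hωn⟩ : ∃ n : ℕ, (n = 0 ∨ ‖y‖ ≤ 2⁻¹ ^ n) ∧ ω (2⁻¹ ^ n) ≤ 2 ^ r * ω t := by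
      rcases le_total 1 t with h1 | h1
      · refine ⟨0, .inl rfl, ?_⟩
        have h2 : ω (2⁻¹ ^ 0) ≤ ω t := hmono (by simp) ht.le (by simpa using h1)
        have h3 : (1 : ℝ) ≤ 2 ^ r := one_le_pow₀ (by norm_num)
        nlinarith
      · obtain ⟨n, hn, hn'⟩ := exists_nat_pow_near (one_le_inv_iff₀.2 ⟨ht, h1⟩) (by norm_num : (1 : ℝ) < 2)
        have h2 : t ≤ 2⁻¹ ^ n := by rw [inv_pow]; exact le_inv_of_le_inv₀ (by positivity) hn
        have h3 : (2 : ℝ)⁻¹ ^ (n + 1) ≤ t := by rw [inv_pow]; exact inv_le_of_inv_le₀ ht hn'.le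
        refine ⟨n, .inr (hy.2.le.trans h2), ?_⟩
        have e2 : (2 : ℝ)⁻¹ ^ n = 2 * 2⁻¹ ^ (n + 1) := by rw [pow_succ]; ring
        rw [e2]
        refine (hω.le_mul_pow (by norm_num) (by positivity) ?_).trans ?_
        · rw [← e2]; exact pow_le_one₀ (by norm_num) (by norm_num)
        · gcongr
          exact hmono (mem_Ici.2 (by positivity)) ht.le h3
    refine (hmod n y α g hn hα hg).trans ?_
    have h0 : 0 ≤ ω (2⁻¹ ^ n) := (hω.pos_of_monotoneOn hmono (by positivity)).le
    have h1 : ENNReal.ofReal (C * ω (2⁻¹ ^ n) ^ 2) ≤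
        ENNReal.ofReal (C * (2 ^ r) ^ 2) * ENNReal.ofReal (ω t ^ 2) := by
      rw [← ENNReal.ofReal_mul (by positivity), mul_assoc C, ← mul_pow]
      gcongr
    rw [hK, mul_assoc _ (ENNReal.ofReal (C * (2 ^ r) ^ 2)), ← ENNReal.ofReal_pow hωt.le]
    exact mul_le_mul' le_rfl h1
  · rintro ⟨hf, hmem⟩
    rw [hFf] at hmem
    have hmemF : MemLp F (ENNReal.ofReal p) volume := hmem.ae_eq hF2.coeFn_toLp
    have h1 := hmemF.2
    rw [eLpNorm_lt_top_iff_lintegral_rpow_enorm_lt_top (by simpa using hp0) ENNReal.ofReal_ne_top,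
      ENNReal.toReal_ofReal hp0.le, hint c p hp0] at h1
    refine hns (summable_of_tsum_ofReal_lt_top (fun k => mul_nonneg (by positivity) (Real.rpow_nonneg (he0 k) _)) ?_)
    simp only [← mul_assoc, ENNReal.tsum_mul_right, hc, shellCoeff_rpow l he0 hp0] at h1
    exact ENNReal.lt_top_of_mul_ne_top_left h1.ne hv0

theorem IsQuasiconcave.inv_two_pow_le {r : ℕ} {ω : ℝ → ℝ} (hω : IsQuasiconcave r ω) (n : ℕ) :
    ω (2⁻¹ ^ n) ≤ 2 ^ r * ω (2⁻¹ ^ (n + 1)) := by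
  have e2 : (2 : ℝ)⁻¹ ^ n = 2 * 2⁻¹ ^ (n + 1) := by rw [pow_succ]; ring
  rw [e2]
  refine hω.le_mul_pow (by norm_num) (by positivity) ?_
  rw [← e2]; exact pow_le_one₀ (by norm_num) (by norm_num)

theorem antitone_inv_two_pow {ω : ℝ → ℝ} (hmono : MonotoneOn ω (Ici 0)) :
    Antitone fun n : ℕ => ω (2⁻¹ ^ n) := fun m n h =>
  hmono (mem_Ici.2 (by positivity)) (mem_Ici.2 (by positivity))
    (pow_le_pow_of_le_one (by norm_num) (by norm_num) h)

theorem theorem4p1 (d r l : ℕ) (hd : 1 ≤ d) (hr : 1 ≤ r) (p : ℝ) (hp0 : 0 < p) (hp2 : p < 2)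
    (ω : ℝ → ℝ) (hω : IsQuasiconcave r ω) (hmono : MonotoneOn ω (Ici 0)) :
    L2Space d ∩ LipSpace d r l ω ⊆ WienerSpace d p ↔
      ((d : ℝ) * (1 / p - 1 / 2) < l ∨
        ((l : ℝ) < d * (1 / p - 1 / 2) ∧ (d : ℝ) * (1 / p - 1 / 2) < l + r ∧
          ∫⁻ t in Ioo (0 : ℝ) 1,
            ENNReal.ofReal (ω t ^ p * t ^ (p * (-(d * (1 / p - 1 / 2)) + l)) / t) < ∞) ∨
        ((d : ℝ) * (1 / p - 1 / 2) = l ∧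
          ∫⁻ t in Ioo (0 : ℝ) 1,
            ENNReal.ofReal (ω t ^ p / Real.log (2 / t) ^ (p / 2) / t) < ∞)) := by
  have hpos : ∀ t, 0 < t → 0 < ω t := fun t ht => hω.pos_of_monotoneOn hmono ht
  have hw : ∀ n : ℕ, 0 < ω (2⁻¹ ^ n) := fun n => hpos _ (by positivity)
  have hanti := antitone_inv_two_pow hmono
  set s : ℝ := d * (1 / p - 1 / 2) with hs
  have hτ : (d : ℝ) * (1 - p / 2) - l * p = p * (s - l) := by rw [hs]; field_simp
  have hII : (l : ℝ) < s → (∫⁻ t in Ioo (0 : ℝ) 1, ENNReal.ofReal (ω t ^ p * t ^ (p * (-s + l)) / t) < ∞ ↔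
      Summable fun n : ℕ => ω (2⁻¹ ^ n) ^ p * (2 : ℝ) ^ (n * (p * (s - l)))) := by
    intro h
    rw [lintegral_rpow_weight_lt_top_iff hp0 (mul_neg_of_pos_of_neg hp0 (by linarith)) hpos hmono,
      show -(p * (-s + l)) = p * (s - l) by ring]
  rw [lintegral_log_weight_lt_top_iff hp0 hpos hmono]
  constructor
  · intro hsub
    by_contra hcon
    push Not at hcon
    obtain ⟨h1, h2, h3⟩ := hcon
    suffices ∃ e : ℕ → ℝ, IsAdmissibleEnergy (4 ^ r) (fun n => ω (2⁻¹ ^ n)) e ∧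
        ¬Summable fun k : ℕ => (2 : ℝ) ^ (k * (p * (s - l))) * e k ^ (p / 2) by
      obtain ⟨e, he, hns⟩ := this
      rw [← hτ] at hns
      obtain ⟨f, hf, hfn⟩ := exists_mem_lipSpace_of_energy hd hp0 hω hmono he hns
      exact hfn (hsub hf)
    -- Failure of all three conditions leaves `l ≤ s`. If `ω` does not tend to `0` at `0`, the
    -- harmonic example works for every such `s`; otherwise the construction depends on whether `s =
    -- l`, `l < s < l + r` or `s ≥ l + r`.
    by_cases hlim : ∀ ε > 0, ∃ n : ℕ, ω (2⁻¹ ^ n) < ε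
    · rcases h1.eq_or_lt with h | h
      · obtain ⟨e, he, hns⟩ := exists_energy_of_log hr hp0 hp2 hw hanti hω.inv_two_pow_le hlim (h3 h.symm)
        refine ⟨e, he, ?_⟩
        simpa [← h] using hns
      · rcases lt_or_ge s (l + r) with h' | h'
        · refine exists_energy_of_tendsto hr hp0 hp2 (mul_pos hp0 (by linarith)) ?_ hw hanti hω.inv_two_pow_le hlim ?_
          · exact mul_lt_mul_of_pos_left (by linarith) hp0
          · intro hsum
            exact absurd ((hII h).2 hsum) (not_lt.2 (h2 h h'))
        · exact exists_energy_of_le hp0 hp2 (mul_le_mul_of_nonneg_left (by linarith) hp0.le) hw hω.inv_two_pow_le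
    · push Not at hlim
      obtain ⟨c, hc, hcw⟩ := hlim
      exact exists_energy_of_pos_le hp0 hp2 (mul_nonneg hp0.le (by linarith)) hc hcw
  · rintro hcases f ⟨hf2, hf⟩
    refine ⟨hf2, ?_⟩
    obtain ⟨C, hC, htail⟩ := exists_lintegral_tail_le hd hω hmono hf2 hf
    refine memLp_of_tsum_dyadicShell_lt_top hd l hp0 hp2 (Lp.stronglyMeasurable _).measurable (Lp.memLp _) ?_
    set e : ℕ → ℝ≥0∞ := fun k => ∫⁻ ξ in dyadicShell d k, ‖ξ‖ₑ ^ (2 * l) *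
      ‖(𝓕 (hf2.toLp f) : Lp ℂ 2 (volume : Measure (EuclideanSpace ℝ (Fin d)))) ξ‖ₑ ^ 2
    have he : ∀ n, ∑' k, e (n + k) ≤ C * ENNReal.ofReal (ω (2⁻¹ ^ n)) ^ 2 := fun n => by
      rw [tsum_lintegral_dyadicShell_add]; exact htail n
    have he1 : ∀ n, e n ≤ C * ENNReal.ofReal (ω (2⁻¹ ^ n)) ^ 2 := fun n =>
      (ENNReal.le_tsum (f := fun k => e (n + k)) 0).trans (he n)
    change ∑' k : ℕ, (2 : ℝ≥0∞) ^ (k * (d * (1 - p / 2) - l * p)) * e k ^ (p / 2) < ∞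
    rw [hτ]
    rcases hcases with h | ⟨h1, -, h3⟩ | ⟨h1, h2⟩
    · refine tsum_lt_top_of_neg (mul_neg_of_pos_of_neg hp0 (by linarith)) (by positivity)
        (M := C * ENNReal.ofReal (ω 1) ^ 2) (ENNReal.mul_ne_top hC (by simp)) fun n => (he1 n).trans ?_
      gcongr
      exact hmono (mem_Ici.2 (by positivity)) (by simp) (pow_le_one₀ (by norm_num) (by norm_num))
    · exact tsum_mul_rpow_lt_top_of_le hp0 hw ((hII h1).1 h3) hC he1
    · simpa [h1] using tsum_rpow_lt_top_of_tail hp0 hp2 hw hanti h2 hC he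

end
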